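/- **Conventions.** Let $n\ge 2$ and let $M=\mathbb R^n$ be Minkowski spacetime with metric $\eta=\mathrm{diag}(1,-1,\dots,-1)$ and open forward light cone $V_+=\{v: v_0>0,\ \eta(v,v)>0\}$. The Borchers--Uhlmann algebra is the topological tensor algebra $\mathcal B=\bigoplus_{m\ge0}C_0^\infty((\mathbb R^n)^m)$ (with $\mathbb C$ for $m=0$), with product $(f\otimes g)(x_1,\dots,x_{j+k})=f(x_1,\dots,x_j)\,g(x_{j+1},\dots,x_{j+k})$ and involution $f^*(x_1,\dots,x_m)=\overline{f(x_m,\dots,x_1)}$. A state $\omega$ is a normalized, positive, continuous linear functional on $\mathcal B$; its $m$-point function $\omega_m\in\mathcal D'((\mathbb R^n)^m)$ is its restriction to the $m$-th summand. For a distribution $\psi$ on $\mathbb R^d$, $(x_0,k_0)$ with $k_0\ne0$ lies outside the analytic wavefront set $\mathrm{WF}_A(\psi)$ iff there are an open neighbourhood $U$ of $x_0$, an open conic neighbourhood $\Gamma$ of $k_0$, a bounded sequence $\psi_N$ $(N\ge 0)$ of compactly supported distributions equal to $\psi$ on $U$, and a constant $C$ with $|k|^N|\hat\psi_N(k)|\le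 C(C(N+1))^N$ for all $N$ and $k\in\Gamma$, where $\hat\psi_N(k)=\psi_N(e^{-ik\cdot})$. Let $\Gamma_m\subset T^*M^m\setminus 0$ be the set of all nonzero $(x_1,k_1;\dots;x_m,k_m)$ for which there is a finite graph $G$ with vertices $1,\dots,m$, in which every edge $e$, from $s(e)$ to $r(e)$, occurs together with its opposite edge $e^{-1}$, and an immersion of $G$ into $M$, that is, for each edge $e$ a piecewise smooth curve $\gamma(e)$ from $x_{s(e)}$ to $x_{r(e)}$ and a covariantly constant causal (nonzero) covector field $k_e$ along $\gamma(e)$, such that $\gamma(e^{-1})$ is the inverse of $\gamma(e)$, $k_{e^{-1}}=-k_e$, $k_e$ is future directed whenever $s(e)<r(e)$, and $k_i=-\sum_{e:\,s(e)=i}k_e(x_i)$ for every $i$. Here a causal covector $k$ is future directed if $k_0=k(\partial_0)>0$. The state $\omega$ satisfies the *analytic microlocal spectrum condition* ($a\mu\mathrm{SC}$) iff $\mathrm{WF}_A(\omega_m)\subset\Gamma_m$ for all $m\ge1$. **Theorem.** For $m\ge 1$ let $T_m=\{(z_1,\dots,z_m)\in(\mathbb C^n)^m:\ \mathrm{Im}(z_{j+1}-z_j)\in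 V_+,\ j=1,\dots,m-1\}$. Let $\omega$ be a state over the Borchers--Uhlmann algebra of $n$-dimensional Minkowski spacetime such that for every $m\ge1$ there are an open neighbourhood $Z\subset(\mathbb C^n)^m$ of $(\mathbb R^n)^m$ and an analytic function $F$ on $T_m\cap Z$ whose boundary value in the sense of distributions is $\omega_m$, i.e. for every $y\in(\mathbb R^n)^m$ with $y_{j+1}-y_j\in V_+$ for $1\le j\le m-1$ and every $f\in C_0^\infty((\mathbb R^n)^m)$, $$\lim_{t\downarrow0}\int F(x+ity)\,f(x)\,dx=\omega_m(f).$$ Then $\omega$ satisfies $a\mu\mathrm{SC}$. -/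

import Mathlib

open Set Filter Topology MeasureTheory TopologicalSpace
open scoped ContDiff Distributions

noncomputable section

/-! ### Distributions and the analytic wavefront set -/

section Microlocal

variable (E : Type*) [NormedAddCommGroup E] [InnerProductSpace ℝ E]

/-- Complex test functions `C₀^∞(E)`, with the canonical LF topology. -/
abbrev TestFn := 𝓓((⊤ : Opens E), ℂ)

/-- Distributions on `E`: continuous complex linear forms on `C₀^∞(E)`. -/
abbrev CDistribution := TestFn E →L[ℂ] ℂ

/-- The complex vector space `C^∞(E)`. -/
def SmoothFn : Submodule ℂ (E → ℂ) where
  carrier := {f | ContDiff ℝ ∞ f}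
  add_mem' := fun {_ _} (hf : ContDiff ℝ ∞ _) (hg : ContDiff ℝ ∞ _) => hf.add hg
  zero_mem' := (contDiff_const : ContDiff ℝ ∞ (fun _ : E => (0 : ℂ)))
  smul_mem' := fun c _ (hf : ContDiff ℝ ∞ _) => hf.const_smul c

variable {E}

/-- A test function regarded as an element of `C^∞(E)`. -/
def TestFn.toSmooth (f : TestFn E) : SmoothFn E := ⟨f, f.contDiff⟩

/-- The plane wave `x ↦ exp (-i k·x)`. -/
def planeWave (k : E) : SmoothFn E :=
  ⟨fun x => Complex.exp (-(Complex.I * ((inner ℝ k x : ℝ) : ℂ))), by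
    have h : ContDiff ℝ ∞ (fun x : E => ((inner ℝ k x : ℝ) : ℂ)) :=
      Complex.ofRealCLM.contDiff.comp (contDiff_const.inner ℝ contDiff_id)
    exact ((contDiff_const.mul h).neg).cexp⟩

/-- `|u f| ≤ C ∑_{j ≤ α} sup_K |D^j f|` for all smooth `f`; a linear form `u` on `C^∞(E)` is a
distribution with compact support iff this holds for some compact `K`, some `C` and some `α`. -/
def SeminormBound (u : SmoothFn E →ₗ[ℂ] ℂ) (K : Set E) (C : ℝ) (α : ℕ) : Prop :=
  ∀ f : SmoothFn E, ‖u f‖ ≤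
    C * ∑ j ∈ Finset.range (α + 1), sSup ((fun x => ‖iteratedFDeriv ℝ j (f : E → ℂ) x‖) '' K)

/-- A bounded sequence of distributions with compact support (bounded in `ℰ'(E)`): all members
satisfy the seminorm estimate with the same `K`, `C`, `α`. -/
def IsBoundedSeq (u : ℕ → (SmoothFn E →ₗ[ℂ] ℂ)) : Prop :=
  ∃ (K : Set E) (C : ℝ) (α : ℕ), IsCompact K ∧ ∀ N, SeminormBound (u N) K C α

/-- The direction `k₀` at `x₀` is analytically regular for `ψ`. -/
def IsAnalyticRegular (ψ : CDistribution E) (x₀ k₀ : E) : Prop :=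
  ∃ U : Set E, IsOpen U ∧ x₀ ∈ U ∧
  ∃ Γ : Set E, IsOpen Γ ∧ k₀ ∈ Γ ∧ (∀ k ∈ Γ, ∀ c : ℝ, 0 < c → c • k ∈ Γ) ∧
  ∃ u : ℕ → (SmoothFn E →ₗ[ℂ] ℂ), IsBoundedSeq u ∧
    (∀ N, ∀ f : TestFn E, tsupport f ⊆ U → u N f.toSmooth = ψ f) ∧
    ∃ C : ℝ, ∀ N : ℕ, ∀ k ∈ Γ,
      ‖k‖ ^ N * ‖u N (planeWave k)‖ ≤ C * (C * ((N : ℝ) + 1)) ^ N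

/-- The analytic wavefront set `WF_A(ψ) ⊆ E × (E \ {0})`. -/
def analyticWF (ψ : CDistribution E) : Set (E × E) :=
  {p | p.2 ≠ 0 ∧ ¬ IsAnalyticRegular ψ p.1 p.2}

end Microlocal

/-! ### The Borchers-Uhlmann algebra of `n`-dimensional Minkowski spacetime -/

/-- The configuration space `(ℝⁿ)^m`; `x (i, μ)` is the `μ`-th coordinate of the `i`-th point. -/
abbrev Conf (n m : ℕ) := EuclideanSpace ℝ (Fin m × Fin n)

/-- `(x₁, …, x_l) ↦ (x_{σ 1}, …, x_{σ m})`. -/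
def Conf.pull {n m l : ℕ} (σ : Fin m → Fin l) (x : Conf n l) : Conf n m :=
  WithLp.toLp 2 (fun p => x (σ p.1, p.2))

theorem Conf.contDiff_pull {n m l : ℕ} (σ : Fin m → Fin l) :
    ContDiff ℝ ∞ (Conf.pull (n := n) σ) := by
  rw [contDiff_euclidean]
  intro p
  exact (contDiff_euclidean.1 contDiff_id) (σ p.1, p.2)

/-- `(x₁, …, x_j), (y₁, …, y_k) ↦ (x₁, …, x_j, y₁, …, y_k)`. -/
def Conf.glue {n j k : ℕ} (p : Conf n j × Conf n k) : Conf n (j + k) :=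
  WithLp.toLp 2 (fun q => Fin.addCases (fun i => p.1 (i, q.2)) (fun i => p.2 (i, q.2)) q.1)

theorem Conf.continuous_glue {n j k : ℕ} : Continuous (Conf.glue (n := n) (j := j) (k := k)) := by
  refine (PiLp.continuous_toLp 2 _).comp (continuous_pi fun q => ?_)
  obtain ⟨i, μ⟩ := q
  induction i using Fin.addCases with
  | left i => simp only [Fin.addCases_left]; fun_prop
  | right i => simp only [Fin.addCases_right]; fun_prop

theorem Conf.glue_pull {n j k : ℕ} (x : Conf n (j + k)) :
    Conf.glue (Conf.pull (Fin.castAdd k) x, Conf.pull (Fin.natAdd j) x) = x := by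
  ext ⟨i, μ⟩
  induction i using Fin.addCases with
  | left i => simp [Conf.glue, Conf.pull]
  | right i => simp [Conf.glue, Conf.pull]

namespace BorchersUhlmann

/-- `(f ⊗ g)(x₁, …, x_{j+k}) = f (x₁, …, x_j) g (x_{j+1}, …, x_{j+k})`. -/
def tensor {n j k : ℕ} (f : TestFn (Conf n j)) (g : TestFn (Conf n k)) :
    TestFn (Conf n (j + k)) where
  toFun x := f (Conf.pull (Fin.castAdd k) x) * g (Conf.pull (Fin.natAdd j) x)
  contDiff' := (f.contDiff.comp (Conf.contDiff_pull _)).mul (g.contDiff.comp (Conf.contDiff_pull _))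
  hasCompactSupport' := by
    refine HasCompactSupport.intro
      ((f.hasCompactSupport.isCompact.prod g.hasCompactSupport.isCompact).image
        Conf.continuous_glue) (fun x hx => ?_)
    by_contra h
    refine hx ⟨(_, _), ⟨subset_tsupport _ ?_, subset_tsupport _ ?_⟩, Conf.glue_pull x⟩
    · exact left_ne_zero_of_mul h
    · exact right_ne_zero_of_mul h
  tsupport_subset' := fun _ _ => trivial

/-- `f*(x₁, …, x_m) = conj (f (x_m, …, x₁))`. -/
def conjRev {n m : ℕ} (f : TestFn (Conf n m)) : TestFn (Conf n m) where
  toFun x := star (f (Conf.pull Fin.rev x))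
  contDiff' := Complex.conjCLE.contDiff.comp (f.contDiff.comp (Conf.contDiff_pull _))
  hasCompactSupport' := by
    refine HasCompactSupport.intro
      (f.hasCompactSupport.isCompact.image (Conf.contDiff_pull Fin.rev).continuous) (fun x hx => ?_)
    by_contra h
    refine hx ⟨Conf.pull Fin.rev x, subset_tsupport _ ?_, ?_⟩
    · intro h0
      exact h (by simp [h0])
    · ext p
      simp [Conf.pull]
  tsupport_subset' := fun _ _ => trivial

/-- The constant function `1` on the one-point space `(ℝⁿ)^0`. -/
def unitFn (n : ℕ) : TestFn (Conf n 0) where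
  toFun _ := 1
  contDiff' := contDiff_const
  hasCompactSupport' := HasCompactSupport.of_compactSpace _
  tsupport_subset' := fun _ _ => trivial

/-- The vector space `⨁_m C₀^∞((ℝⁿ)^m)` underlying the Borchers-Uhlmann algebra, the `m`-th summand
being the (completed) `m`-fold tensor power of `C₀^∞(ℝⁿ)`; the summand `m = 0` is `ℂ`. -/
abbrev Carrier (n : ℕ) := DirectSum ℕ (fun m => TestFn (Conf n m))

/-- The unit element. -/
def one (n : ℕ) : Carrier n := DirectSum.of (fun m => TestFn (Conf n m)) 0 (unitFn n)

open Classical in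
/-- The product. -/
def mul {n : ℕ} (a b : Carrier n) : Carrier n :=
  ∑ j ∈ DFinsupp.support a, ∑ k ∈ DFinsupp.support b,
    DirectSum.of (fun m => TestFn (Conf n m)) (j + k) (tensor (a j) (b k))

open Classical in
/-- The involution. -/
def star {n : ℕ} (a : Carrier n) : Carrier n :=
  ∑ j ∈ DFinsupp.support a, DirectSum.of (fun m => TestFn (Conf n m)) j (conjRev (a j))

/-- A state over the Borchers-Uhlmann algebra: a normalized positive linear functional which is
continuous for the direct sum topology, that is, continuous on every summand. -/
structure State (n : ℕ) where
  /-- the functional -/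
  toFun : Carrier n →ₗ[ℂ] ℂ
  continuous_summand : ∀ m,
    Continuous (fun f : TestFn (Conf n m) => toFun (DirectSum.lof ℂ ℕ _ m f))
  map_one : toFun (one n) = 1
  nonneg : ∀ a, 0 ≤ (toFun (mul (star a) a)).re ∧ (toFun (mul (star a) a)).im = 0

/-- The `m`-point function `w_m ∈ 𝒟'((ℝⁿ)^m)` of a state. -/
def State.pointFunction {n : ℕ} (w : State n) (m : ℕ) : CDistribution (Conf n m) where
  toLinearMap := w.toFun ∘ₗ DirectSum.lof ℂ ℕ (fun m => TestFn (Conf n m)) m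
  cont := w.continuous_summand m

end BorchersUhlmann

/-! ### Metrics, covariantly constant covectors, Minkowski spacetime -/

/-- A metric in a global chart `ℝⁿ`, given by its component matrix `g_{μν}(x)`. -/
abbrev ChartMetric (n : ℕ) := (Fin n → ℝ) → Matrix (Fin n) (Fin n) ℝ

/-- The Christoffel symbols `Γ^l_{μν} = ½ g^{ls} (∂_μ g_{sν} + ∂_ν g_{sμ} - ∂_s g_{μν})`. -/
def christoffel {n : ℕ} (g : ChartMetric n) (x : Fin n → ℝ) (l μ ν : Fin n) : ℝ :=
  let d (a b c : Fin n) : ℝ := fderiv ℝ (fun y => g y b c) x (Pi.single a 1)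
  (1 / 2) * ∑ s, (g x)⁻¹ l s * (d μ s ν + d ν s μ - d s μ ν)

/-- A continuous curve on `[0, 1]` that is smooth, up to the end points, on each of the closed
intervals into which finitely many break points divide `[0, 1]`. -/
def IsPiecewiseSmooth {n : ℕ} (γ : ℝ → (Fin n → ℝ)) : Prop :=
  ContinuousOn γ (Icc 0 1) ∧ ∃ S : Finset ℝ, ∀ a b : ℝ, 0 ≤ a → a < b → b ≤ 1 →
    (∀ s ∈ S, s ∉ Ioo a b) → ContDiffOn ℝ ∞ γ (Icc a b)

/-- The covector field `k` along the piecewise smooth curve `γ` on `[0, 1]` is covariantly constant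
for the Levi-Civita connection of `g`: `dk_ν/dt = Γ^l_{μν} (dγ^μ/dt) k_l` away from break points. -/
def IsCovariantlyConstant {n : ℕ} (g : ChartMetric n) (γ k : ℝ → (Fin n → ℝ)) : Prop :=
  ContinuousOn k (Icc 0 1) ∧ ∃ S : Finset ℝ, ∀ t ∈ Ioo (0 : ℝ) 1, t ∉ S →
    DifferentiableAt ℝ γ t ∧ ∀ ν, HasDerivAt (fun r => k r ν)
      (∑ l, ∑ μ, christoffel g (γ t) l μ ν * deriv γ t μ * k t l) t

/-- The covector `k` at `x` is causal (for a metric of signature `(+, -, …, -)`). -/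
def IsCausalCovector {n : ℕ} (g : ChartMetric n) (x k : Fin n → ℝ) : Prop :=
  k ≠ 0 ∧ 0 ≤ ∑ μ, ∑ ν, (g x)⁻¹ μ ν * k μ * k ν

section Minkowski

variable (n : ℕ) [NeZero n]

/-- The Minkowski metric `diag(1, -1, …, -1)`; the coordinate `0` is time. -/
def minkowskiMetric : ChartMetric n := fun _ => Matrix.diagonal (fun μ => if μ = 0 then 1 else -1)

/-- The open forward light cone `V₊`. -/
def forwardCone : Set (Fin n → ℝ) :=
  {v | 0 < v 0 ∧ 0 < ∑ μ, ∑ ν, minkowskiMetric n 0 μ ν * v μ * v ν}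

/-- The cone of all `(y₁, …, y_m)` with `y_{j+1} - y_j ∈ V₊` for `1 ≤ j ≤ m - 1`. -/
def tubeCone (m : ℕ) : Set (Fin m × Fin n → ℝ) :=
  {y | ∀ (j : ℕ) (h : j + 1 < m),
    (fun μ => y (⟨j + 1, h⟩, μ) - y (⟨j, Nat.lt_of_succ_lt h⟩, μ)) ∈ forwardCone n}

/-- The forward tube `T_m ⊆ (ℂⁿ)^m`. -/
def forwardTube (m : ℕ) : Set (Fin m × Fin n → ℂ) :=
  {z | (fun p => (z p).im) ∈ tubeCone n m}

/-- `ψ` is the boundary value, in the sense of distributions, of a function `F` that is analytic in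
`T_m ∩ Z` for an open neighbourhood `Z ⊆ (ℂⁿ)^m` of the real points: for each direction `y` of the
tube, `F(· + i t y)` tends to `ψ` as distributions as `t ↓ 0`. -/
def IsTubeBoundaryValue (m : ℕ) (ψ : CDistribution (Conf n m)) : Prop :=
  ∃ Z : Set (Fin m × Fin n → ℂ), IsOpen Z ∧ (∀ x : Fin m × Fin n → ℝ, (fun p => (x p : ℂ)) ∈ Z) ∧
  ∃ F : (Fin m × Fin n → ℂ) → ℂ, AnalyticOnNhd ℂ F (forwardTube n m ∩ Z) ∧
    ∀ y ∈ tubeCone n m, ∀ f : TestFn (Conf n m),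
      Tendsto (fun t : ℝ => ∫ x : Conf n m,
          F (fun p => (x p : ℂ) + Complex.I * ((t * y p : ℝ) : ℂ)) * f x)
        (𝓝[>] 0) (𝓝 (ψ f))

/-- A finite graph with vertices `1, …, m` (multiple edges and loops allowed), each edge of which
occurs in both directions. -/
structure EdgeGraph (m : ℕ) where
  /-- the number of directed edges -/
  numEdges : ℕ
  /-- the source of an edge -/
  src : Fin numEdges → Fin m
  /-- the target of an edge -/
  tgt : Fin numEdges → Fin m
  /-- the edge with opposite direction -/
  inv : Fin numEdges → Fin numEdges
  inv_inv : ∀ e, inv (inv e) = e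
  inv_ne : ∀ e, inv e ≠ e
  src_inv : ∀ e, src (inv e) = tgt e
  tgt_inv : ∀ e, tgt (inv e) = src e

/-- An immersion of the graph `G` into Minkowski spacetime. -/
structure GraphImmersion {m : ℕ} (G : EdgeGraph m) where
  /-- the point assigned to a vertex -/
  pt : Fin m → (Fin n → ℝ)
  /-- the curve assigned to an edge, parametrized by `[0, 1]` -/
  curve : Fin G.numEdges → ℝ → (Fin n → ℝ)
  /-- the covector field along that curve -/
  covec : Fin G.numEdges → ℝ → (Fin n → ℝ)
  piecewiseSmooth : ∀ e, IsPiecewiseSmooth (curve e)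
  curve_zero : ∀ e, curve e 0 = pt (G.src e)
  curve_one : ∀ e, curve e 1 = pt (G.tgt e)
  covariantlyConstant : ∀ e, IsCovariantlyConstant (minkowskiMetric n) (curve e) (covec e)
  causal : ∀ e, ∀ t ∈ Icc (0 : ℝ) 1, IsCausalCovector (minkowskiMetric n) (curve e t) (covec e t)
  curve_inv : ∀ e, ∀ t ∈ Icc (0 : ℝ) 1, curve (G.inv e) t = curve e (1 - t)
  /-- the covector is directed towards the future, i.e. positive on the time direction `∂₀` -/
  future : ∀ e, G.src e < G.tgt e → ∀ t ∈ Icc (0 : ℝ) 1, 0 < covec e t 0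
  covec_inv : ∀ e, ∀ t ∈ Icc (0 : ℝ) 1, covec (G.inv e) t = -covec e (1 - t)

/-- The set `Γ_m ⊆ T*M^m \ 0` of the microlocal spectrum condition, `M` Minkowski spacetime. -/
def microlocalCone (m : ℕ) : Set (Conf n m × Conf n m) :=
  {q | q.2 ≠ 0 ∧ ∃ (G : EdgeGraph m) (J : GraphImmersion n G),
    (∀ i μ, q.1 (i, μ) = J.pt i μ) ∧
    ∀ i μ, q.2 (i, μ) = -∑ e with G.src e = i, J.covec e 0 μ}

variable {n}

/-- The analytic microlocal spectrum condition: `WF_A(w_m) ⊆ Γ_m` for all `m ≥ 1`. -/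
def BorchersUhlmann.State.IsAnalyticMicrolocalSpectrum (w : BorchersUhlmann.State n) : Prop :=
  ∀ m, 1 ≤ m → analyticWF (w.pointFunction m) ⊆ microlocalCone n m

end Minkowski

end

/-! The theorem splits into an analytic estimate and linear algebra. If `ψ` is the boundary value of
`F(x + ity)` as `t ↓ 0` and `k₀·y < 0`, then `k₀` is analytically regular for `ψ` at every point.
Letting `y` run over `tubeCone` forces every covector of `WF_A` into the dual cone of `tubeCone`,
and this dual cone lies in `Γ_m`.

Analytic part (`isAnalyticRegular_of_boundaryValue`). Formally one shifts the contour to `x + iTy`,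
where `e^{-ik·z}` has modulus `e^{T k·y}`, exponentially small in `k`. A cutoff is not analytic, so
for each `N` one uses a cutoff `χ₀` whose derivatives `χ_j = ∂_y^j χ₀` grow only like `(cM)^j` for
`j ≤ M`, with `M` comparable to `N`. Put `m_j(s) = e^{s k·y} ∫ F(x + isy) χ_j(x) e^{-ik·x} dx`. The
Cauchy–Riemann equation and integration by parts give `m_j' = -i m_{j+1}`. Taylor expansion of `m_0`
at `τ` about `τ + T` leaves a polynomial part with the factor `e^{-c'|k|T}` and a remainder
controlled by `s^n/n! e^{-c'|k|s} ≤ (c'|k|)^{-n}`; then `τ ↓ 0`. The constants are uniform in `τ`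
because the integrals against `F(· + ity)` are equicontinuous on test functions supported in a
compact set, by Banach–Steinhaus. The resulting seminorm order `L` costs a factor `|k|^L`, paid for
by taking `n = N + L`.

Linear algebra (`mem_microlocalCone_of_nonneg_tubeCone`). The tube cone is translation invariant, so
a dual covector satisfies `∑ k_l = 0`, and its tail sums `P_j = ∑_{l>j} k_l` lie in the closed
forward cone. Since `k_i = P_{i-1} - P_i`, the chain graph whose edge from `j` to `j+1` carries
`P_j` realizes `k`. -/

noncomputable section

/-! ### Completeness of `𝓓_K` and uniform boundedness -/

namespace ContDiffMapSupportedIn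

variable {E F : Type*} [NormedAddCommGroup E] [NormedSpace ℝ E] [NormedAddCommGroup F]
  [NormedSpace ℝ F]

/-- If all derivatives converge uniformly, the limits are again the derivatives of the limit
function. This makes `𝓓_K` a closed subspace of a countable product of Banach spaces when `F` is
complete. -/
theorem isClosed_range_structureMapCLM (K : Compacts E) :
    IsClosed (range (ContinuousLinearMap.pi (structureMapCLM ℝ ⊤) :
      𝓓_{K}(E, F) →L[ℝ] Π i, BoundedContinuousFunction E (E [×i]→L[ℝ] F))) := by
  refine IsSeqClosed.isClosed fun u G hu hG => ?_
  choose f hf using hu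
  have hfu : ∀ n i x, u n i x = iteratedFDeriv ℝ i (f n) x := fun n i x => by
    rw [← hf n, ← structureMapCLM_top_apply ℝ]; rfl
  rw [tendsto_pi_nhds] at hG
  have hlim : ∀ i x, Tendsto (fun n => iteratedFDeriv ℝ i (f n) x) atTop (𝓝 (G i x)) := by
    intro i x
    have := (BoundedContinuousFunction.tendsto_iff_tendstoUniformly.1 (hG i)).tendsto_at x
    simpa only [hfu] using this
  have hT : HasFTaylorSeriesUpTo ∞ (fun x => (G 0 x).curry0) (fun x i => G i x) := by
    refine ⟨fun x => rfl, fun i _ x => ?_, fun i _ => (G i).continuous⟩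
    refine hasFDerivAt_of_tendstoUniformly (l := atTop)
      (f := fun n x => iteratedFDeriv ℝ i (f n) x)
      (f' := fun n x => (iteratedFDeriv ℝ (i + 1) (f n) x).curryLeft)
      (g' := fun x => (G (i + 1) x).curryLeft) ?_ ?_ (hlim i) x
    · have h1 := BoundedContinuousFunction.tendsto_iff_tendstoUniformly.1 (hG (i + 1))
      have h2 := ((continuousMultilinearCurryLeftEquiv ℝ (fun _ : Fin (i + 1) => E) F)
        ).isometry.uniformContinuous.comp_tendstoUniformly h1
      have h3 : (fun n => (continuousMultilinearCurryLeftEquiv ℝ (fun _ : Fin (i + 1) => E) F) ∘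
          (u n (i + 1))) = fun n x => (iteratedFDeriv ℝ (i + 1) (f n) x).curryLeft := by
        funext n y
        simp only [Function.comp, hfu]
        rfl
      rwa [h3] at h2
    · intro n x
      have := ((f n).contDiff.ftaylorSeries).fderiv i (by exact_mod_cast WithTop.coe_lt_top i) x
      exact this
  have hz : ∀ x ∉ (K : Set E), (G 0 x).curry0 = 0 := by
    intro x hx
    have h0 : G 0 x = 0 := by
      refine tendsto_nhds_unique (hlim 0 x) ?_
      simp only [(f _).iteratedFDeriv_zero_on_compl hx]
      exact tendsto_const_nhds
    rw [h0]; rfl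
  refine ⟨⟨fun x => (G 0 x).curry0, hT.contDiff, fun x hx => hz x hx⟩, ?_⟩
  ext i x : 2
  have h1 : (structureMapCLM ℝ ⊤ i (⟨fun x => (G 0 x).curry0, hT.contDiff, fun x hx => hz x hx⟩ :
      𝓓_{K}(E, F)) : E → _) = _ := structureMapCLM_top_apply ℝ _
  have h2 := hT.eq_iteratedFDeriv (m := i) (by exact_mod_cast le_top) x
  exact (congrFun h1 x).trans h2.symm

/-- Supplies the Baire property behind Banach–Steinhaus on `𝓓_K`. -/
instance isCompletelyPseudoMetrizableSpace [CompleteSpace F] (K : Compacts E) :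
    IsCompletelyPseudoMetrizableSpace 𝓓_{K}(E, F) :=
  IsClosedEmbedding.IsCompletelyPseudoMetrizableSpace
    (f := (ContinuousLinearMap.pi (structureMapCLM ℝ ⊤) :
      𝓓_{K}(E, F) →L[ℝ] Π i, BoundedContinuousFunction E (E [×i]→L[ℝ] F)))
    ⟨(isUniformEmbedding_pi_structureMapCLM ℝ).isEmbedding, isClosed_range_structureMapCLM K⟩

/-- Pointwise bounded families of functions, integrated against test functions supported in a fixed
compact set, satisfy a common seminorm estimate. -/
theorem exists_uniform_bound [MeasurableSpace E] [BorelSpace E] (μ : Measure E)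
    [IsFiniteMeasureOnCompacts μ]
    (K : Compacts E) {ι : Type*} (φ : ι → E → ℂ) (hφ : ∀ i, IntegrableOn (φ i) K μ)
    (hb : ∀ g : 𝓓_{K}(E, ℂ), ∃ M, ∀ i, ‖∫ x, φ i x * g x ∂μ‖ ≤ M) :
    ∃ (A : ℝ) (L : ℕ), 0 ≤ A ∧ ∀ i, ∀ g : 𝓓_{K}(E, ℂ), ∀ B, 0 ≤ B →
      (∀ j ≤ L, ∀ x, ‖iteratedFDeriv ℝ j g x‖ ≤ B) → ‖∫ x, φ i x * g x ∂μ‖ ≤ A * B := by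
  have : IsFiniteMeasure (μ.restrict K) := ⟨by
    rw [Measure.restrict_apply_univ]; exact K.isCompact.measure_lt_top⟩
  let T : ι → 𝓓_{K}(E, ℂ) →L[ℂ] ℂ := fun i =>
    integralAgainstBilinCLM (ContinuousLinearMap.mul ℂ ℂ) μ (φ i)
  have hT : ∀ i g, T i g = ∫ x, φ i x * g x ∂μ := fun i g => by
    rw [integralAgainstBilinCLM_eq_integral (hφ i)]
    simp [mul_comm]
  have hue := (norm_withSeminorms ℂ ℂ).banach_steinhaus (𝓕 := T) (by
    intro _ g
    obtain ⟨M, hM⟩ := hb g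
    refine ⟨M, ?_⟩
    rintro _ ⟨i, rfl⟩
    simpa [hT] using hM i)
  obtain ⟨p, hp, hle⟩ := ((norm_withSeminorms ℂ ℂ).uniformEquicontinuous_iff_exists_continuous_seminorm
    (fun i => (T i).toLinearMap)).1 hue 0
  obtain ⟨s, C, -, hC⟩ := Seminorm.bound_of_continuous
    (ContDiffMapSupportedIn.withSeminorms ℂ E ℂ ⊤ K) p hp
  -- Continuity involves only finitely many seminorms; `L` is the highest order among them.
  refine ⟨C, s.sup id, C.2, fun i g B hB h => ?_⟩
  rw [← hT]
  have h1 : ‖T i g‖ ≤ p g := hle i g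
  refine h1.trans ((hC g).trans ?_)
  change (C : ℝ) * (s.sup (ContDiffMapSupportedIn.seminorm ℂ E ℂ ⊤ K)) g ≤ _
  refine mul_le_mul_of_nonneg_left ?_ C.2
  refine Seminorm.finset_sup_apply_le hB fun j hj => ?_
  rw [ContDiffMapSupportedIn.seminorm_top_le_iff ℂ hB]
  exact fun x _ => h j (Finset.le_sup (f := id) hj) x

end ContDiffMapSupportedIn

/-! ### Cutoff functions with controlled derivatives -/

/-- The average of `g` over the interval `[s - h, s + h]`. -/
def movingAverage (h : ℝ) (g : ℝ → ℂ) (s : ℝ) : ℂ := (1 / (2 * h) : ℝ) • ∫ u in (s - h)..(s + h), g u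

section movingAverage

variable {h : ℝ} {g : ℝ → ℂ}

theorem hasDerivAt_movingAverage (hg : Continuous g) (s : ℝ) :
    HasDerivAt (movingAverage h g) ((1 / (2 * h) : ℝ) • (g (s + h) - g (s - h))) s := by
  have hP : ∀ t, HasDerivAt (fun t => ∫ u in (0 : ℝ)..t, g u) (g t) t := fun t =>
    intervalIntegral.integral_hasDerivAt_right (hg.intervalIntegrable _ _)
      hg.aestronglyMeasurable.stronglyMeasurableAtFilter hg.continuousAt
  have h1 := ((hP (s + h)).comp_add_const s h).sub ((hP (s - h)).comp_sub_const s h)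
  refine (h1.const_smul (1 / (2 * h) : ℝ)).congr_of_eventuallyEq (Eventually.of_forall fun t => ?_)
  simp only [movingAverage, Pi.smul_apply, Pi.sub_apply]
  rw [intervalIntegral.integral_interval_sub_left (hg.intervalIntegrable _ _)
    (hg.intervalIntegrable _ _)]

theorem deriv_movingAverage (hg : Continuous g) :
    deriv (movingAverage h g) = fun s => (1 / (2 * h) : ℝ) • (g (s + h) - g (s - h)) :=
  funext fun s => (hasDerivAt_movingAverage hg s).deriv

theorem contDiff_movingAverage (hg : ContDiff ℝ ∞ g) : ContDiff ℝ ∞ (movingAverage h g) := by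
  rw [contDiff_infty_iff_deriv]
  refine ⟨fun s => (hasDerivAt_movingAverage hg.continuous s).differentiableAt, ?_⟩
  rw [deriv_movingAverage hg.continuous]
  exact ((hg.comp (contDiff_id.add contDiff_const)).sub
    (hg.comp (contDiff_id.sub contDiff_const))).const_smul _

theorem iteratedDeriv_succ_movingAverage (hg : ContDiff ℝ ∞ g) (i : ℕ) (s : ℝ) :
    iteratedDeriv (i + 1) (movingAverage h g) s =
      (1 / (2 * h) : ℝ) • (iteratedDeriv i g (s + h) - iteratedDeriv i g (s - h)) := by
  rw [iteratedDeriv_succ', deriv_movingAverage hg.continuous]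
  have hi : ContDiff ℝ i g := hg.of_le (by exact_mod_cast le_top)
  have h1 : ContDiff ℝ i (fun s => g (s + h)) := hi.comp (contDiff_id.add contDiff_const)
  have h2 : ContDiff ℝ i (fun s => g (s - h)) := hi.comp (contDiff_id.sub contDiff_const)
  rw [iteratedDeriv_fun_const_smul_field, iteratedDeriv_fun_sub h1.contDiffAt h2.contDiffAt,
    iteratedDeriv_comp_add_const, iteratedDeriv_comp_sub_const]

/-- The derivative of an average is a symmetric difference quotient, so one further derivative costs
only `h⁻¹`. -/
theorem norm_iteratedDeriv_succ_movingAverage_le (hh : 0 < h) (hg : ContDiff ℝ ∞ g) {i : ℕ} {B : ℝ}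
    (hB : ∀ s, ‖iteratedDeriv i g s‖ ≤ B) (s : ℝ) :
    ‖iteratedDeriv (i + 1) (movingAverage h g) s‖ ≤ h⁻¹ * B := by
  rw [iteratedDeriv_succ_movingAverage hg, norm_smul, Real.norm_of_nonneg (by positivity)]
  calc 1 / (2 * h) * ‖iteratedDeriv i g (s + h) - iteratedDeriv i g (s - h)‖
      ≤ 1 / (2 * h) * (B + B) := by
        gcongr
        exact (norm_sub_le _ _).trans (add_le_add (hB _) (hB _))
    _ = h⁻¹ * B := by field_simp; ring

theorem norm_iteratedDeriv_movingAverage_le (hh : 0 < h) (hg : ContDiff ℝ ∞ g) {i : ℕ} {B : ℝ}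
    (hB : ∀ s, ‖iteratedDeriv i g s‖ ≤ B) (s : ℝ) :
    ‖iteratedDeriv i (movingAverage h g) s‖ ≤ B := by
  have hs : ‖(s + h) - (s - h)‖ = 2 * h := by
    rw [Real.norm_of_nonneg] <;> linarith
  cases i with
  | zero =>
    simp only [iteratedDeriv_zero] at hB ⊢
    rw [movingAverage, norm_smul, Real.norm_of_nonneg (by positivity)]
    have := intervalIntegral.norm_integral_le_of_norm_le_const (a := s - h) (b := s + h)
      (f := g) (C := B) fun u _ => hB u
    calc _ ≤ 1 / (2 * h) * (B * (2 * h)) := by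
          gcongr
          rwa [← Real.norm_eq_abs, hs] at this
      _ = B := by field_simp
  | succ i =>
    rw [iteratedDeriv_succ_movingAverage hg, norm_smul, Real.norm_of_nonneg (by positivity)]
    have hd : Differentiable ℝ (iteratedDeriv i g) :=
      hg.differentiable_iteratedDeriv i (by exact_mod_cast WithTop.coe_lt_top i)
    have := Convex.norm_image_sub_le_of_norm_deriv_le (f := iteratedDeriv i g) (C := B)
      (s := univ) (x := s - h) (y := s + h) (fun x _ => hd x)
      (fun x _ => by rw [← iteratedDeriv_succ]; exact hB x) convex_univ trivial trivial
    rw [hs] at this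
    calc _ ≤ 1 / (2 * h) * (B * (2 * h)) := by gcongr
      _ = B := by field_simp

theorem movingAverage_eq_one (hh : 0 < h) {r : ℝ} (hg : ∀ s, |s| ≤ r → g s = 1) {s : ℝ}
    (hs : |s| ≤ r - h) : movingAverage h g s = 1 := by
  have : ∫ u in (s - h)..(s + h), g u = ∫ u in (s - h)..(s + h), (1 : ℂ) := by
    refine intervalIntegral.integral_congr fun u hu => ?_
    rw [uIcc_of_le (by linarith)] at hu
    refine hg u (abs_le.2 ?_)
    have := abs_le.1 hs
    constructor <;> linarith [hu.1, hu.2]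
  rw [movingAverage, this, intervalIntegral.integral_const, smul_smul,
    show 1 / (2 * h) * (s + h - (s - h)) = 1 by field_simp; ring, one_smul]

theorem movingAverage_eq_zero (hh : 0 < h) {r : ℝ} (hg : ∀ s, r < |s| → g s = 0) {s : ℝ}
    (hs : r + h < |s|) : movingAverage h g s = 0 := by
  have : ∫ u in (s - h)..(s + h), g u = ∫ u in (s - h)..(s + h), (0 : ℂ) := by
    refine intervalIntegral.integral_congr fun u hu => ?_
    rw [uIcc_of_le (by linarith)] at hu
    refine hg u ?_
    rcases lt_abs.1 hs with h1 | h1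
    · exact lt_abs.2 (Or.inl (by linarith [hu.1]))
    · exact lt_abs.2 (Or.inr (by linarith [hu.2]))
  rw [movingAverage, this, intervalIntegral.integral_zero, smul_zero]

theorem contDiff_iterate_movingAverage (hg : ContDiff ℝ ∞ g) (M : ℕ) :
    ContDiff ℝ ∞ ((movingAverage h)^[M] g) := by
  induction M generalizing g with
  | zero => exact hg
  | succ M ih => exact ih (contDiff_movingAverage hg)

theorem iterate_movingAverage_eq_one (hh : 0 < h) (M : ℕ) {r : ℝ} (hg : ∀ s, |s| ≤ r → g s = 1)
    {s : ℝ} (hs : |s| ≤ r - M * h) : (movingAverage h)^[M] g s = 1 := by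
  induction M generalizing g r with
  | zero => exact hg s (by simpa using hs)
  | succ M ih =>
    refine ih (r := r - h) (fun s hs => movingAverage_eq_one hh hg hs) ?_
    push_cast at hs
    linarith

theorem iterate_movingAverage_eq_zero (hh : 0 < h) (M : ℕ) {r : ℝ} (hg : ∀ s, r < |s| → g s = 0)
    {s : ℝ} (hs : r + M * h < |s|) : (movingAverage h)^[M] g s = 0 := by
  induction M generalizing g r with
  | zero => exact hg s (by simpa using hs)
  | succ M ih =>
    refine ih (r := r + h) (fun s hs => movingAverage_eq_zero hh hg hs) ?_
    push_cast at hs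
    linarith

/-- Of the `M` averages, `j` absorb one derivative each at cost `h⁻¹`; the others do not increase
the bound. Only `i` derivatives ever reach `g`. -/
theorem norm_iteratedDeriv_iterate_movingAverage_le (hh : 0 < h) (M : ℕ) (hg : ContDiff ℝ ∞ g)
    {i j : ℕ} (hj : j ≤ M) {B : ℝ} (hB : ∀ s, ‖iteratedDeriv i g s‖ ≤ B) (s : ℝ) :
    ‖iteratedDeriv (i + j) ((movingAverage h)^[M] g) s‖ ≤ h⁻¹ ^ j * B := by
  induction M generalizing g i j B with
  | zero => obtain rfl : j = 0 := by omega
            simpa using hB s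
  | succ M ih =>
    rcases hj.lt_or_eq with hlt | rfl
    · exact ih (contDiff_movingAverage hg) (by omega)
        (norm_iteratedDeriv_movingAverage_le hh hg hB)
    · have := ih (contDiff_movingAverage hg) (i := i + 1) (le_refl M)
        (norm_iteratedDeriv_succ_movingAverage_le hh hg hB)
      rw [show i + (M + 1) = i + 1 + M by omega, pow_succ, mul_assoc]
      exact this

end movingAverage

/-- Cutoff functions on the line whose derivatives up to order `i + M` are controlled by powers
of `M`. -/
theorem exists_analytic_cutoff {ρ : ℝ} (hρ : 0 < ρ) : ∃ B : ℕ → ℝ, ∀ M : ℕ, 1 ≤ M →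
    ∃ a : ℝ → ℂ, ContDiff ℝ ∞ a ∧ (∀ s, |s| ≤ ρ → a s = 1) ∧ (∀ s, 4 * ρ < |s| → a s = 0) ∧
      ∀ i j, j ≤ M → ∀ s, ‖iteratedDeriv (i + j) a s‖ ≤ (M / ρ) ^ j * B i := by
  let b : ContDiffBump (0 : ℝ) := ⟨2 * ρ, 3 * ρ, by linarith, by linarith⟩
  let g : ℝ → ℂ := fun s => (b s : ℂ)
  have hg : ContDiff ℝ ∞ g := Complex.ofRealCLM.contDiff.comp b.contDiff
  have hgc : HasCompactSupport g := b.hasCompactSupport.comp_left Complex.ofReal_zero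
  have hB : ∀ i, ∃ B, ∀ s, ‖iteratedDeriv i g s‖ ≤ B := fun i => by
    obtain ⟨C, hC⟩ := (hg.continuous_iteratedFDeriv (m := i) (by exact_mod_cast le_top)
      ).bounded_above_of_compact_support (hgc.iteratedFDeriv (𝕜 := ℝ) i)
    exact ⟨C, fun s => by rw [← norm_iteratedFDeriv_eq_norm_iteratedDeriv]; exact hC s⟩
  choose B hB using hB
  -- The `M` averages of half-width `ρ / M` move the edges by `ρ` in total: the plateau shrinks from
  -- `2ρ` to `ρ`, the support grows from `3ρ` to `4ρ`.
  refine ⟨B, fun M hM => ⟨(movingAverage (ρ / M))^[M] g, contDiff_iterate_movingAverage hg M, ?_⟩⟩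
  have hM' : (0 : ℝ) < M := by exact_mod_cast hM
  have hMh : M * (ρ / M) = ρ := by field_simp
  refine ⟨fun s hs => ?_, fun s hs => ?_, fun i j hj s => ?_⟩
  · refine iterate_movingAverage_eq_one (by positivity) M (r := 2 * ρ) (fun s hs => ?_)
      (by rw [hMh]; linarith)
    have : b s = 1 := b.one_of_mem_closedBall (by simpa using hs)
    simp [g, this]
  · refine iterate_movingAverage_eq_zero (by positivity) M (r := 3 * ρ) (fun s hs => ?_)
      (by rw [hMh]; linarith)
    have : b s = 0 := b.zero_of_le_dist (by simpa using! hs.le)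
    simp [g, this]
  · have := norm_iteratedDeriv_iterate_movingAverage_le (h := ρ / M) (by positivity) M hg hj (hB i) s
    rwa [inv_div] at this

/-! ### Differentiation of integrals of boundary-value type -/

section

variable {E : Type*} [NormedAddCommGroup E]

theorem ContinuousOn.continuous_mul_of_tsupport_subset {f g : E → ℂ} {O : Set E} (hO : IsOpen O)
    (hf : ContinuousOn f O) (hg : Continuous g) (hgO : tsupport g ⊆ O) :
    Continuous fun x => f x * g x := by
  refine continuous_of_tsupport fun x hx => ?_
  exact (hf.continuousAt (hO.mem_nhds (hgO (tsupport_mul_subset_right hx)))).mul hg.continuousAt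

theorem ContinuousOn.integrable_mul_of_tsupport_subset [MeasurableSpace E] [BorelSpace E]
    {μ : Measure E} [IsFiniteMeasureOnCompacts μ] {f g : E → ℂ} {O : Set E} (hO : IsOpen O)
    (hf : ContinuousOn f O) (hg : Continuous g) (hgc : HasCompactSupport g)
    (hgO : tsupport g ⊆ O) : Integrable (fun x => f x * g x) μ :=
  (hf.continuous_mul_of_tsupport_subset hO hg hgO).integrable_of_hasCompactSupport hgc.mul_left

variable [NormedSpace ℝ E] [FiniteDimensional ℝ E] [MeasurableSpace E] [BorelSpace E] {μ : Measure E}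
  [μ.IsAddHaarMeasure]

/-- If `∂ₛ Φ = i ∂_y Φ` then `d/ds ∫ Φ(x, s) g(x) dx = -i ∫ Φ(x, s) ∂_y g(x) dx`. -/
theorem hasDerivAt_integral_mul_of_fderiv_eq {O : Set E} {S : ℝ} {y : E}
    {Φ : E × ℝ → ℂ} (hO : IsOpen O) (hΦ : ContDiffOn ℝ 1 Φ (O ×ˢ Ioo 0 S))
    (hCR : ∀ p ∈ O ×ˢ Ioo 0 S, fderiv ℝ Φ p (0, 1) = Complex.I * fderiv ℝ Φ p (y, 0))
    {g g' : E → ℂ} (hg : Continuous g) (hg' : Continuous g') (hgc : HasCompactSupport g)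
    (hgO : tsupport g ⊆ O) (hgg' : ∀ x, HasLineDerivAt ℝ g (g' x) x y)
    {s : ℝ} (hs : s ∈ Ioo 0 S) :
    HasDerivAt (fun s => ∫ x, Φ (x, s) * g x ∂μ) (-(Complex.I * ∫ x, Φ (x, s) * g' x ∂μ)) s := by
  have hD : IsOpen (O ×ˢ Ioo 0 S) := hO.prod isOpen_Ioo
  have hcd := hΦ.continuousOn_fderiv_of_isOpen hD le_rfl
  have hslice : ∀ t ∈ Ioo 0 S, ContinuousOn (fun x => Φ (x, t)) O := fun t ht =>
    hΦ.continuousOn.comp (by fun_prop) fun x hx => ⟨hx, ht⟩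
  have hdslice : ∀ v : E × ℝ, ∀ t ∈ Ioo 0 S, ContinuousOn (fun x => fderiv ℝ Φ (x, t) v) O :=
    fun v t ht => (hcd.comp (f := fun x : E => (x, t)) (by fun_prop) fun x hx => ⟨hx, ht⟩).clm_apply
      continuousOn_const
  have hfd : ∀ p ∈ O ×ˢ Ioo 0 S, HasFDerivAt Φ (fderiv ℝ Φ p) p := fun p hp =>
    ((hΦ.differentiableOn one_ne_zero).differentiableAt (hD.mem_nhds hp)).hasFDerivAt
  have htg' : tsupport g' ⊆ tsupport g := by
    refine closure_minimal (fun x hx => ?_) isClosed_closure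
    by_contra hxn
    have h0 : g =ᶠ[𝓝 x] 0 := notMem_tsupport_iff_eventuallyEq.1 hxn
    refine hx ?_
    have h1 : HasLineDerivAt ℝ g 0 x y := by
      have h2 : HasLineDerivAt ℝ (0 : E → ℂ) 0 x y := by
        simpa using! (hasFDerivAt_const (0 : ℂ) x).hasLineDerivAt y
      exact h2.congr_of_eventuallyEq h0
    exact (hgg' x).unique h1
  have hgc' : HasCompactSupport g' := hgc.mono' (subset_tsupport _ |>.trans htg')
  obtain ⟨ε, hε, hball⟩ : ∃ ε > 0, Metric.closedBall s ε ⊆ Ioo 0 S :=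
    Metric.nhds_basis_closedBall.mem_iff.1 (isOpen_Ioo.mem_nhds hs)
  obtain ⟨C, hC⟩ : ∃ C, ∀ p ∈ tsupport g ×ˢ Metric.closedBall s ε, ‖fderiv ℝ Φ p (0, 1)‖ ≤ C := by
    refine (hgc.isCompact.prod (isCompact_closedBall s ε)).exists_bound_of_continuousOn ?_
    exact (hcd.mono (prod_mono hgO hball)).clm_apply continuousOn_const
  have key := hasDerivAt_integral_of_dominated_loc_of_deriv_le (μ := μ) (x₀ := s)
    (F := fun t x => Φ (x, t) * g x) (F' := fun t x => fderiv ℝ Φ (x, t) (0, 1) * g x)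
    (bound := fun x => C * ‖g x‖) (s := Metric.ball s ε)
    (Metric.ball_mem_nhds s hε) ?_ ?_ ?_ ?_ ?_ ?_
  · refine key.2.congr_deriv ?_
    -- The Cauchy–Riemann equation turns the `s`-derivative into a `y`-derivative of `Φ`, which is
    -- moved onto `g`.
    have hparts := integral_bilinear_hasLineDerivAt_right_eq_neg_left_of_integrable (μ := μ)
      (f := fun x => Φ (x, s)) (f' := fun x => fderiv ℝ Φ (x, s) (y, 0)) (g := g) (g' := g')
      (v := y) (B := ContinuousLinearMap.mul ℝ ℂ)
      ((hdslice _ s hs).integrable_mul_of_tsupport_subset hO hg hgc hgO)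
      ((hslice s hs).integrable_mul_of_tsupport_subset hO hg' hgc' (htg'.trans hgO))
      ((hslice s hs).integrable_mul_of_tsupport_subset hO hg hgc hgO)
      (fun x hx => ?_) (fun x _ => hgg' x)
    · simp only [ContinuousLinearMap.mul_apply'] at hparts
      rw [hparts, mul_neg, neg_neg, ← integral_const_mul]
      refine integral_congr_ae (Eventually.of_forall fun x => ?_)
      by_cases hx : x ∈ tsupport g
      · simp only [hCR (x, s) ⟨hgO hx, hs⟩, mul_assoc]
      · simp [image_eq_zero_of_notMem_tsupport hx]
    · have h1 := hfd (x, s) ⟨hgO hx, hs⟩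
      have h2 : HasFDerivAt (fun x : E => (x, s)) (ContinuousLinearMap.inl ℝ E ℝ) x :=
        hasFDerivAt_prodMk_left x s
      simpa using! (h1.comp x h2).hasLineDerivAt y
  · filter_upwards [isOpen_Ioo.mem_nhds hs] with t ht
    exact ((hslice t ht).continuous_mul_of_tsupport_subset hO hg hgO).aestronglyMeasurable
  · exact (hslice s hs).integrable_mul_of_tsupport_subset hO hg hgc hgO
  · exact ((hdslice _ s hs).continuous_mul_of_tsupport_subset hO hg hgO).aestronglyMeasurable
  · refine Eventually.of_forall fun x t ht => ?_
    by_cases hx : x ∈ tsupport g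
    · rw [norm_mul]
      gcongr
      exact hC _ ⟨hx, Metric.ball_subset_closedBall ht⟩
    · simp [image_eq_zero_of_notMem_tsupport hx]
  · exact (hg.norm.integrable_of_hasCompactSupport hgc.norm).const_mul C
  · refine Eventually.of_forall fun x t ht => ?_
    by_cases hx : x ∈ tsupport g
    · have h1 := hfd (x, t) ⟨hgO hx, hball (Metric.ball_subset_closedBall ht)⟩
      have h2 : HasDerivAt (fun t : ℝ => (x, t)) ((0 : E), (1 : ℝ)) t :=
        (hasDerivAt_const t x).prodMk (hasDerivAt_id t)
      exact (h1.comp_hasDerivAt t h2).mul_const _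
    · simpa [image_eq_zero_of_notMem_tsupport hx] using hasDerivAt_const t (0 : ℂ)

end

/-! ### A Taylor estimate -/

/-- The derivative telescopes: differentiating a power cancels against differentiating the preceding
`m j`, and only the top term survives. -/
theorem hasDerivAt_taylor_sum {m : ℕ → ℝ → ℂ} {τ S : ℝ}
    (hm : ∀ j, ∀ s ∈ Ioo 0 S, HasDerivAt (m j) (-(Complex.I * m (j + 1) s)) s)
    (N : ℕ) {s : ℝ} (hs : τ + s ∈ Ioo 0 S) :
    HasDerivAt (fun s : ℝ => ∑ j ∈ Finset.range (N + 1),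
        (Complex.I * s) ^ j / (j.factorial : ℂ) * m j (τ + s))
      (-(Complex.I * ((Complex.I * s) ^ N / (N.factorial : ℂ) * m (N + 1) (τ + s)))) s := by
  have hmτ : ∀ j, HasDerivAt (fun s => m j (τ + s)) (-(Complex.I * m (j + 1) (τ + s))) s :=
    fun j => (hm j _ hs).comp_const_add τ s
  induction N with
  | zero => simpa using hmτ 0
  | succ N ih =>
    simp_rw [Finset.sum_range_succ _ (N + 1)]
    have hI : HasDerivAt (fun s : ℝ => Complex.I * (s : ℂ)) Complex.I s := by
      simpa using (Complex.ofRealCLM.hasDerivAt (x := s)).const_mul Complex.I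
    have hpow := ((hI.pow (N + 1)).div_const ((N + 1).factorial : ℂ)).mul (hmτ (N + 1))
    refine (ih.add hpow).congr_deriv ?_
    have hf : ((N + 1).factorial : ℂ) = (N + 1) * N.factorial := by
      rw [Nat.factorial_succ]; push_cast; ring
    have h0 : (N.factorial : ℂ) ≠ 0 := by exact_mod_cast N.factorial_ne_zero
    have h1 : (N + 1 : ℂ) ≠ 0 := by exact_mod_cast N.succ_ne_zero
    rw [hf]
    simp only [Nat.add_sub_cancel, Pi.pow_apply]
    push_cast
    field_simp
    ring

/-- Taylor's formula for `m 0` at `τ` with centre `τ + S`. The base point stays positive because the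
derivatives are available only on the open interval. -/
theorem norm_le_taylor {m : ℕ → ℝ → ℂ} {T : ℝ}
    (hm : ∀ j, ∀ s ∈ Ioo 0 T, HasDerivAt (m j) (-(Complex.I * m (j + 1) s)) s)
    (N : ℕ) {τ S B : ℝ} (hτ : 0 < τ) (hS : 0 ≤ S) (hT : τ + S < T)
    (hB : ∀ s, 0 ≤ s → s ≤ S → s ^ N / N.factorial * ‖m (N + 1) (τ + s)‖ ≤ B) :
    ‖m 0 τ‖ ≤ ∑ j ∈ Finset.range (N + 1), S ^ j / j.factorial * ‖m j (τ + S)‖ + B * S := by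
  let H : ℝ → ℂ := fun s => ∑ j ∈ Finset.range (N + 1),
        (Complex.I * s) ^ j / (j.factorial : ℂ) * m j (τ + s)
  have hd : ∀ s ∈ Icc 0 S, HasDerivAt H
      (-(Complex.I * ((Complex.I * s) ^ N / (N.factorial : ℂ) * m (N + 1) (τ + s)))) s :=
    fun s hs => hasDerivAt_taylor_sum hm N ⟨by linarith [hs.1], by linarith [hs.2]⟩
  have h1 := norm_image_sub_le_of_norm_deriv_le_segment' (f := H) (C := B)
    (fun s hs => (hd s hs).hasDerivWithinAt) (fun s hs => by
      simpa [abs_of_nonneg hs.1] using hB s hs.1 hs.2.le) S (right_mem_Icc.2 hS)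
  have h0 : H 0 = m 0 τ := by
    simp only [H, Finset.sum_range_succ']
    simp
  rw [h0, sub_zero] at h1
  have h2 : ‖H S‖ ≤ ∑ j ∈ Finset.range (N + 1), S ^ j / j.factorial * ‖m j (τ + S)‖ := by
    refine (norm_sum_le _ _).trans (Finset.sum_le_sum fun j _ => le_of_eq ?_)
    simp [abs_of_nonneg hS]
  have h3 := norm_sub_norm_le (m 0 τ) (H S)
  rw [norm_sub_rev] at h3
  linarith

/-! ### Elementary estimates -/

theorem pow_div_factorial_mul_exp_neg_le {x c : ℝ} (hx : 0 ≤ x) (hc : 0 < c) (N : ℕ) :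
    x ^ N / N.factorial * Real.exp (-(c * x)) ≤ c⁻¹ ^ N := by
  have h := Real.pow_div_factorial_le_exp (c * x) (by positivity) N
  rw [Real.exp_neg]
  calc x ^ N / N.factorial * (Real.exp (c * x))⁻¹
      = c⁻¹ ^ N * (((c * x) ^ N / N.factorial) * (Real.exp (c * x))⁻¹) := by
        rw [mul_pow, inv_pow]; field_simp
    _ ≤ c⁻¹ ^ N * (Real.exp (c * x) * (Real.exp (c * x))⁻¹) := by gcongr
    _ = c⁻¹ ^ N := by rw [mul_inv_cancel₀ (Real.exp_pos _).ne', mul_one]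

/-- Shifting the order by a constant is harmless in estimates of analytic type. -/
theorem exists_const_pow_shift (D Q : ℝ) (hD : 0 ≤ D) (hQ : 1 ≤ Q) (L : ℕ) : ∃ C : ℝ, 1 ≤ C ∧
    ∀ N : ℕ, D * (Q * (N + L + 1 : ℕ)) ^ (N + L + 1) ≤ C * (C * ((N : ℝ) + 1)) ^ N := by
  set q : ℝ := Q * (L + 1) with hq
  have hq1 : 1 ≤ q := one_le_mul_of_one_le_of_one_le hQ (by linarith [(Nat.cast_nonneg L : (0:ℝ) ≤ L)])
  have key : ∀ N : ℕ, D * (Q * (N + L + 1 : ℕ)) ^ (N + L + 1) ≤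
      (D * q ^ (L + 1)) * ((q * 2 ^ (L + 1)) * ((N : ℝ) + 1)) ^ N := by
    intro N
    have h1 : Q * ((N + L + 1 : ℕ) : ℝ) ≤ q * (N + 1) := by
      rw [hq, mul_assoc]
      gcongr
      push_cast
      nlinarith [(Nat.cast_nonneg L : (0:ℝ) ≤ L), (Nat.cast_nonneg N : (0:ℝ) ≤ N),
        mul_nonneg (Nat.cast_nonneg L : (0:ℝ) ≤ L) (Nat.cast_nonneg N : (0:ℝ) ≤ N)]
    -- The surplus factor `(N + 1)^(L + 1)` is thus absorbed into the base of the `N`-th power.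
    have h2 : ((N : ℝ) + 1) ≤ 2 ^ N := by exact_mod_cast Nat.lt_two_pow_self
    calc D * (Q * (N + L + 1 : ℕ)) ^ (N + L + 1) ≤ D * (q * (N + 1)) ^ (N + L + 1) := by gcongr
      _ = (D * q ^ (L + 1)) * (q * (N + 1)) ^ N * ((N : ℝ) + 1) ^ (L + 1) := by
          rw [add_assoc, pow_add, mul_pow q _ (L + 1)]; ring
      _ ≤ (D * q ^ (L + 1)) * (q * (N + 1)) ^ N * (2 ^ N) ^ (L + 1) := by gcongr
      _ = _ := by rw [← pow_mul, mul_comm N, pow_mul, mul_right_comm q, mul_pow (q * _) _ N]; ring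
  refine ⟨max 1 (max (D * q ^ (L + 1)) (q * 2 ^ (L + 1))), le_max_left _ _, fun N => ?_⟩
  refine (key N).trans ?_
  gcongr
  · exact (le_max_left _ _).trans (le_max_right _ _)
  · exact (le_max_right _ _).trans (le_max_right _ _)

/-- In the first term `κ^n e^{-c'κS} ≤ n! (c'S)^{-n}`; in the second the powers of `κ` cancel. Both
are then of size `(const · (n+1))^(n+1)`, uniformly in `κ`. -/
theorem exists_const_analytic_decay {c c' S : ℝ} (hc : 0 < c) (hc' : 0 < c') (hS : 0 < S) :
    ∃ Q : ℝ, 1 ≤ Q ∧ ∀ (n : ℕ) (κ : ℝ), 0 < κ →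
      κ ^ n * (Real.exp (-(c' * κ * S)) * Real.exp (S * (c * (n + 1 : ℕ))) +
        (c * (n + 1 : ℕ)) ^ (n + 1) * (c' * κ)⁻¹ ^ n * S) ≤
      (1 + S) * (Q * (n + 1 : ℕ)) ^ (n + 1) := by
  set Q₁ : ℝ := (1 + (c' * S)⁻¹) * Real.exp (S * c) with hQ₁
  set Q₂ : ℝ := c * (1 + c'⁻¹) with hQ₂
  have hi : 0 < (c' * S)⁻¹ := by positivity
  have hi' : 0 < c'⁻¹ := by positivity
  have hQ₁1 : 1 ≤ Q₁ := one_le_mul_of_one_le_of_one_le (by linarith)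
    (Real.one_le_exp (by positivity))
  have hQ₂0 : 0 ≤ Q₂ := by positivity
  refine ⟨Q₁ + Q₂, by linarith, fun n κ hκ => ?_⟩
  have hn : (1 : ℝ) ≤ (n + 1 : ℕ) := by exact_mod_cast Nat.succ_pos n
  have h1 : κ ^ n * Real.exp (-(c' * κ * S)) ≤
      (1 + (c' * S)⁻¹) ^ (n + 1) * ((n + 1 : ℕ) : ℝ) ^ (n + 1) := by
    have h := pow_div_factorial_mul_exp_neg_le hκ.le (mul_pos hc' hS) n
    have hf : (0 : ℝ) < n.factorial := by exact_mod_cast n.factorial_pos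
    have hfn : (n.factorial : ℝ) ≤ ((n + 1 : ℕ) : ℝ) ^ (n + 1) := by
      exact_mod_cast (Nat.factorial_le (Nat.le_succ n)).trans (Nat.factorial_le_pow _)
    rw [show c' * κ * S = c' * S * κ by ring]
    calc κ ^ n * Real.exp (-(c' * S * κ))
        = (κ ^ n / n.factorial * Real.exp (-(c' * S * κ))) * n.factorial := by field_simp
      _ ≤ (c' * S)⁻¹ ^ n * ((n + 1 : ℕ) : ℝ) ^ (n + 1) := by gcongr
      _ ≤ (1 + (c' * S)⁻¹) ^ (n + 1) * ((n + 1 : ℕ) : ℝ) ^ (n + 1) := by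
        gcongr ?_ * _
        calc (c' * S)⁻¹ ^ n ≤ (1 + (c' * S)⁻¹) ^ n := by gcongr; linarith
          _ ≤ _ := pow_le_pow_right₀ (by linarith) (Nat.le_succ n)
  have h2 : κ ^ n * ((c * (n + 1 : ℕ)) ^ (n + 1) * (c' * κ)⁻¹ ^ n) ≤
      (Q₂ * (n + 1 : ℕ)) ^ (n + 1) := by
    have : κ ^ n * ((c * (n + 1 : ℕ)) ^ (n + 1) * (c' * κ)⁻¹ ^ n) =
        (c * (n + 1 : ℕ)) ^ (n + 1) * c'⁻¹ ^ n := by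
      have : κ ^ n * κ⁻¹ ^ n = 1 := by rw [← mul_pow, mul_inv_cancel₀ hκ.ne', one_pow]
      rw [mul_inv, mul_pow c'⁻¹]
      linear_combination (c * (n + 1 : ℕ)) ^ (n + 1) * c'⁻¹ ^ n * this
    rw [this, hQ₂, mul_right_comm, mul_pow _ (1 + c'⁻¹)]
    gcongr
    calc c'⁻¹ ^ n ≤ (1 + c'⁻¹) ^ n := by gcongr; linarith
      _ ≤ _ := pow_le_pow_right₀ (by linarith) (Nat.le_succ n)
  have h3 : Real.exp (S * (c * (n + 1 : ℕ))) = Real.exp (S * c) ^ (n + 1) := by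
    rw [← Real.exp_nat_mul]; congr 1; ring
  calc _ = κ ^ n * Real.exp (-(c' * κ * S)) * Real.exp (S * c) ^ (n + 1) +
        S * (κ ^ n * ((c * (n + 1 : ℕ)) ^ (n + 1) * (c' * κ)⁻¹ ^ n)) := by rw [h3]; ring
    _ ≤ (1 + (c' * S)⁻¹) ^ (n + 1) * ((n + 1 : ℕ) : ℝ) ^ (n + 1) * Real.exp (S * c) ^ (n + 1) +
        S * (Q₂ * (n + 1 : ℕ)) ^ (n + 1) := by gcongr
    _ = (Q₁ * (n + 1 : ℕ)) ^ (n + 1) + S * (Q₂ * (n + 1 : ℕ)) ^ (n + 1) := by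
        rw [hQ₁]; simp only [mul_pow]; ring
    _ ≤ ((Q₁ + Q₂) * (n + 1 : ℕ)) ^ (n + 1) + S * ((Q₁ + Q₂) * (n + 1 : ℕ)) ^ (n + 1) := by
        gcongr <;> linarith
    _ = _ := by ring

/-! ### Bounds for iterated derivatives -/

section

variable {E G : Type*} [NormedAddCommGroup E] [NormedSpace ℝ E] [NormedAddCommGroup G]
  [NormedSpace ℝ G]

theorem norm_iteratedFDeriv_comp_clm_sub_le {f : G → ℂ} (hf : ContDiff ℝ ∞ f) (l : E →L[ℝ] G)
    (c : G) (i : ℕ) (x : E) :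
    ‖iteratedFDeriv ℝ i (fun x => f (l x - c)) x‖ ≤ ‖iteratedFDeriv ℝ i f (l x - c)‖ * ‖l‖ ^ i := by
  have h1 : ContDiff ℝ ∞ (fun z => f (z - c)) := hf.comp (contDiff_id.sub contDiff_const)
  have h2 := l.iteratedFDeriv_comp_right h1 x (i := i) (by exact_mod_cast le_top)
  change ‖iteratedFDeriv ℝ i ((fun z => f (z - c)) ∘ l) x‖ ≤ _
  rw [h2, iteratedFDeriv_comp_sub]
  exact (ContinuousMultilinearMap.norm_compContinuousLinearMap_le _ _).trans (by simp)

theorem norm_iteratedFDeriv_mul_le_of_le {f g : E → ℂ} (hf : ContDiff ℝ ∞ f) (hg : ContDiff ℝ ∞ g)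
    {a b : ℝ} {i : ℕ} {x : E} (ha : ∀ j ≤ i, ‖iteratedFDeriv ℝ j f x‖ ≤ a)
    (hb : ∀ j ≤ i, ‖iteratedFDeriv ℝ j g x‖ ≤ b) :
    ‖iteratedFDeriv ℝ i (fun x => f x * g x) x‖ ≤ 2 ^ i * (a * b) := by
  have ha0 : 0 ≤ a := (norm_nonneg _).trans (ha 0 (Nat.zero_le _))
  refine (norm_iteratedFDeriv_mul_le hf hg x (n := i) (by exact_mod_cast le_top)).trans ?_
  calc _ ≤ ∑ j ∈ Finset.range (i + 1), (i.choose j : ℝ) * (a * b) := by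
        refine Finset.sum_le_sum fun j hj => ?_
        rw [mul_assoc]
        gcongr
        · exact ha j (Nat.lt_succ_iff.1 (Finset.mem_range.1 hj))
        · exact hb _ (Nat.sub_le _ _)
    _ = _ := by
        rw [← Finset.sum_mul]
        congr 1
        exact_mod_cast Nat.sum_range_choose i

end

/-! ### Plane waves and directional cutoffs -/

section

variable {E : Type*} [NormedAddCommGroup E] [InnerProductSpace ℝ E]

theorem planeWave_apply (k x : E) :
    (planeWave k : E → ℂ) x = Complex.exp (-(Complex.I * ((inner ℝ k x : ℝ) : ℂ))) := rfl

theorem norm_iteratedFDeriv_planeWave_le (k : E) (i : ℕ) (x : E) :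
    ‖iteratedFDeriv ℝ i (planeWave k : E → ℂ) x‖ ≤ ‖k‖ ^ i := by
  let e : ℝ → ℂ := fun t => Complex.exp (-(Complex.I * t))
  have hlin : ∀ t : ℝ, HasDerivAt (fun t : ℝ => -(Complex.I * (t : ℂ))) (-Complex.I) t := fun t => by
    simpa using! ((Complex.ofRealCLM.hasDerivAt (x := t)).const_mul Complex.I).neg
  have he : ContDiff ℝ ∞ e :=
    ((contDiff_const.mul Complex.ofRealCLM.contDiff).neg).cexp
  have hd : ∀ i, iteratedDeriv i e = fun t => (-Complex.I) ^ i * e t := by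
    intro i
    induction i with
    | zero => simp
    | succ i ih =>
      rw [iteratedDeriv_succ, ih]
      funext t
      rw [((hlin t).cexp.const_mul _).deriv]
      simp only [e]
      ring
  have hn : ∀ t, ‖iteratedFDeriv ℝ i e t‖ = 1 := by
    intro t
    rw [norm_iteratedFDeriv_eq_norm_iteratedDeriv, hd]
    simp [e, Complex.norm_exp]
  have h := norm_iteratedFDeriv_comp_clm_sub_le he (innerSL ℝ k) 0 i x
  simp only [sub_zero, hn, one_mul, innerSL_apply_norm] at h
  exact h

theorem hasLineDerivAt_planeWave (k x y : E) :
    HasLineDerivAt ℝ (planeWave k : E → ℂ)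
      (-(Complex.I * ((inner ℝ k y : ℝ) : ℂ)) * (planeWave k : E → ℂ) x) x y := by
  have h1 : HasFDerivAt (fun x : E => inner ℝ k x) (innerSL ℝ k) x := (innerSL ℝ k).hasFDerivAt
  have h2 := (((Complex.ofRealCLM.hasFDerivAt (x := inner ℝ k x)).comp x h1).const_mul
    Complex.I).neg.cexp
  refine HasDerivAt.congr_deriv (h2.hasLineDerivAt y) ?_
  simp [planeWave_apply, mul_comm]

end

/-- Cutoff functions near `x₀`, together with their iterated derivatives in the direction `y`, whose
`C^i`-norms are controlled analytically. -/
theorem exists_directional_cutoff {E : Type*} [NormedAddCommGroup E] [InnerProductSpace ℝ E]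
    [FiniteDimensional ℝ E] {x₀ y : E} (hy : y ≠ 0) {U : Set E} (hU : U ∈ 𝓝 x₀) :
    ∃ (V : Set E) (K : Compacts E) (c : ℝ) (B : ℕ → ℝ), IsOpen V ∧ x₀ ∈ V ∧ (K : Set E) ⊆ U ∧
      0 < c ∧ ∀ M : ℕ, 1 ≤ M → ∃ χ : ℕ → E → ℂ, (∀ j, ContDiff ℝ ∞ (χ j)) ∧
        (∀ j, Function.support (χ j) ⊆ K) ∧ (∀ x ∈ V, χ 0 x = 1) ∧
        (∀ j x, HasLineDerivAt ℝ (χ j) (χ (j + 1) x) x y) ∧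
        ∀ i j, j ≤ M → ∀ x, ‖iteratedFDeriv ℝ i (χ j) x‖ ≤ B i * (c * M) ^ j := by
  obtain ⟨r, hr, hrU⟩ := Metric.nhds_basis_closedBall.mem_iff.1 hU
  obtain ⟨ρ, hρ, hρr⟩ : ∃ ρ > 0, (2 + 4 * ‖y‖) * ρ ≤ r :=
    ⟨r / (2 + 4 * ‖y‖), by positivity, by rw [mul_div_cancel₀]; positivity⟩
  -- Split `x = P x + l x • y` with `l y = 1` and `P y = 0`. In a product of a function of `l x` and
  -- a function of `P x`, derivatives along `y` fall only on the first factor, so only that one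
  -- needs analytic bounds.
  let l : E →L[ℝ] ℝ := (‖y‖ ^ 2)⁻¹ • innerSL ℝ y
  let P : E →L[ℝ] E := ContinuousLinearMap.id ℝ E - l.smulRight y
  have hly : l y = 1 := by
    have : ‖y‖ ^ 2 ≠ 0 := by positivity
    simp [l, this]
  have hP : ∀ x, P x = x - l x • y := fun x => rfl
  have hPy : P y = 0 := by rw [hP, hly, one_smul, sub_self]
  let b : ContDiffBump (0 : E) := ⟨ρ, 2 * ρ, hρ, by linarith⟩
  let β : E → ℂ := fun x => (b x : ℂ)
  have hβ : ContDiff ℝ ∞ β := Complex.ofRealCLM.contDiff.comp b.contDiff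
  have hβc : HasCompactSupport β := b.hasCompactSupport.comp_left Complex.ofReal_zero
  have hBβ : ∀ i, ∃ B, ∀ x, ‖iteratedFDeriv ℝ i β x‖ ≤ B := fun i =>
    (hβ.continuous_iteratedFDeriv (m := i) (by exact_mod_cast le_top)
      ).bounded_above_of_compact_support (hβc.iteratedFDeriv (𝕜 := ℝ) i)
  choose Bβ hBβ using hBβ
  obtain ⟨Ba, hBa⟩ := exists_analytic_cutoff hρ
  have hBβ0 : ∀ i, 0 ≤ Bβ i := fun i => (norm_nonneg _).trans (hBβ i 0)
  refine ⟨{x | |l x - l x₀| < ρ ∧ ‖P x - P x₀‖ < ρ}, ⟨Metric.closedBall x₀ r, isCompact_closedBall _ _⟩,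
    1 / ρ, fun i => 2 ^ i * ((∑ j ∈ Finset.range (i + 1), |Ba j| * ‖l‖ ^ j) *
      (∑ j ∈ Finset.range (i + 1), Bβ j * ‖P‖ ^ j)), ?_, ?_, hrU, by positivity, fun M hM => ?_⟩
  · exact (isOpen_lt (by fun_prop : Continuous fun x => |l x - l x₀|) continuous_const).inter
      (isOpen_lt (by fun_prop : Continuous fun x => ‖P x - P x₀‖) continuous_const)
  · simp [hρ]
  obtain ⟨a, ha, ha1, ha0, haB⟩ := hBa M hM
  have haj : ∀ j, ContDiff ℝ ∞ (iteratedDeriv j a) := fun j =>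
    contDiff_infty.2 fun n => by
      rw [iteratedDeriv_eq_iterate]
      exact ContDiff.iterate_deriv' n j (ha.of_le (by exact_mod_cast le_top))
  have ha0' : ∀ j s, 4 * ρ < |s| → iteratedDeriv j a s = 0 := by
    intro j s hs
    have : a =ᶠ[𝓝 s] fun _ => 0 := by
      filter_upwards [(isOpen_lt continuous_const continuous_abs).mem_nhds hs] with t ht using ha0 t ht
    rw [this.iteratedDeriv_eq]
    simp
  have hα : ∀ j, ContDiff ℝ ∞ fun x => iteratedDeriv j a (l x - l x₀) := fun j =>
    (haj j).comp (l.contDiff.sub contDiff_const)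
  have hβ' : ContDiff ℝ ∞ fun x => β (P x - P x₀) := hβ.comp (P.contDiff.sub contDiff_const)
  refine ⟨fun j x => iteratedDeriv j a (l x - l x₀) * β (P x - P x₀), fun j => (hα j).mul hβ',
    fun j x hx => ?_, fun x hx => ?_, fun j x => ?_, fun i j hj x => ?_⟩
  · have h1 : |l x - l x₀| ≤ 4 * ρ := by
      by_contra! h
      exact hx (by simp [ha0' j _ h])
    have h2 : ‖P x - P x₀‖ ≤ 2 * ρ := by
      by_contra! h
      have : b (P x - P x₀) = 0 := b.zero_of_le_dist (by simpa using! h.le)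
      exact hx (by simp [β, this])
    have h3 : x - x₀ = (P x - P x₀) + (l x - l x₀) • y := by
      rw [hP, hP, sub_smul]; abel
    change dist x x₀ ≤ r
    rw [dist_eq_norm, h3]
    refine (norm_add_le _ _).trans ?_
    rw [norm_smul, Real.norm_eq_abs]
    nlinarith [mul_le_mul_of_nonneg_right h1 (norm_nonneg y)]
  · have h1 : b (P x - P x₀) = 1 := b.one_of_mem_closedBall (by simpa using! hx.2.le)
    simp [β, h1, ha1 _ hx.1.le]
  · have h1 : HasLineDerivAt ℝ (fun x => iteratedDeriv j a (l x - l x₀))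
        (iteratedDeriv (j + 1) a (l x - l x₀)) x y := by
      have hd : HasDerivAt (iteratedDeriv j a) (iteratedDeriv (j + 1) a (l x - l x₀)) (l x - l x₀) := by
        rw [iteratedDeriv_succ]
        exact ((haj j).differentiable (by simp) _).hasDerivAt
      have h := (hd.hasFDerivAt.comp x (l.hasFDerivAt.sub_const (l x₀))).hasLineDerivAt y
      simpa [hly] using! h
    have h2 : HasLineDerivAt ℝ (fun x => β (P x - P x₀)) 0 x y := by
      have h := ((hβ.differentiable (by simp) (P x - P x₀)).hasFDerivAt.comp x
        (P.hasFDerivAt.sub_const (P x₀))).hasLineDerivAt y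
      simpa [hPy] using! h
    have h3 := HasDerivAt.mul (h1 : HasDerivAt _ _ _) (h2 : HasDerivAt _ _ _)
    simpa [HasLineDerivAt] using! h3
  · have hm : ∀ (j : ℕ) (b : ℕ → ℝ), (∀ q, 0 ≤ b q) → ∀ q ≤ i,
        b q ≤ ∑ j ∈ Finset.range (i + 1), b j := fun j b hb q hq =>
      Finset.single_le_sum (f := b) (fun q _ => hb q) (Finset.mem_range.2 (Nat.lt_succ_of_le hq))
    refine (norm_iteratedFDeriv_mul_le_of_le (hα j) hβ'
      (a := (∑ j ∈ Finset.range (i + 1), |Ba j| * ‖l‖ ^ j) * (1 / ρ * M) ^ j)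
      (b := ∑ j ∈ Finset.range (i + 1), Bβ j * ‖P‖ ^ j) (fun q hq => ?_) fun q hq => ?_).trans
      (le_of_eq (by ring))
    · refine (norm_iteratedFDeriv_comp_clm_sub_le (haj j) l _ q x).trans ?_
      rw [norm_iteratedFDeriv_eq_norm_iteratedDeriv, iteratedDeriv_eq_iterate,
        iteratedDeriv_eq_iterate, ← Function.iterate_add_apply, ← iteratedDeriv_eq_iterate]
      have h1 := haB q j hj (l x - l x₀)
      rw [one_div_mul_eq_div]
      calc _ ≤ ((M / ρ) ^ j * |Ba q|) * ‖l‖ ^ q := by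
            gcongr
            exact h1.trans (by gcongr; exact le_abs_self _)
        _ = (|Ba q| * ‖l‖ ^ q) * (M / ρ) ^ j := by ring
        _ ≤ _ := by
            gcongr
            exact hm q (fun j => |Ba j| * ‖l‖ ^ j) (fun q => by positivity) q hq
    · refine (norm_iteratedFDeriv_comp_clm_sub_le hβ P _ q x).trans ?_
      refine le_trans ?_ (hm q (fun j => Bβ j * ‖P‖ ^ j)
        (fun q => mul_nonneg (hBβ0 q) (by positivity)) q hq)
      gcongr
      exact hBβ _ _

/-! ### Analytic regularity of boundary values -/

section

variable {E : Type*} [NormedAddCommGroup E] [InnerProductSpace ℝ E]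

/-- Multiplication by a cutoff function, as a linear map `C^∞(E) → C₀^∞(E)`. -/
def SmoothFn.cutoff (χ : E → ℂ) (hχ : ContDiff ℝ ∞ χ) (hc : HasCompactSupport χ) :
    SmoothFn E →ₗ[ℂ] TestFn E where
  toFun f := ⟨fun x => χ x * (f : E → ℂ) x, hχ.mul f.2, hc.mul_right, fun _ _ => trivial⟩
  map_add' f g := TestFunction.ext fun x => mul_add (χ x) ((f : E → ℂ) x) ((g : E → ℂ) x)
  map_smul' c f := TestFunction.ext fun x => mul_left_comm (χ x) c ((f : E → ℂ) x)

theorem SmoothFn.cutoff_apply (χ : E → ℂ) (hχ : ContDiff ℝ ∞ χ) (hc : HasCompactSupport χ)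
    (f : SmoothFn E) (x : E) : cutoff χ hχ hc f x = χ x * (f : E → ℂ) x := rfl

variable [FiniteDimensional ℝ E] [MeasurableSpace E] [BorelSpace E] {μ : Measure E}
  [μ.IsAddHaarMeasure] {ψ : CDistribution E} {O : Set E} {S : ℝ} {y : E} {Φ : E × ℝ → ℂ}

/-- A distributional boundary value and its approximants satisfy a common seminorm estimate. -/
theorem exists_boundaryValue_bound (hO : IsOpen O) (hΦ : ContDiffOn ℝ 1 Φ (O ×ˢ Ioo 0 S))
    (hCR : ∀ p ∈ O ×ˢ Ioo 0 S, fderiv ℝ Φ p (0, 1) = Complex.I * fderiv ℝ Φ p (y, 0))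
    (hlim : ∀ f : TestFn E, tsupport f ⊆ O →
      Tendsto (fun t => ∫ x, Φ (x, t) * f x ∂μ) (𝓝[>] 0) (𝓝 (ψ f)))
    (K : Compacts E) (hK : (K : Set E) ⊆ O) {T : ℝ} (hT : 0 < T) (hTS : T < S) :
    ∃ (A : ℝ) (L : ℕ), 0 ≤ A ∧ ∀ f : TestFn E, Function.support f ⊆ K → ∀ B, 0 ≤ B →
      (∀ j ≤ L, ∀ x, ‖iteratedFDeriv ℝ j f x‖ ≤ B) →
      (∀ t ∈ Ioc 0 T, ‖∫ x, Φ (x, t) * f x ∂μ‖ ≤ A * B) ∧ ‖ψ f‖ ≤ A * B := by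
  have hmem : ∀ t ∈ Ioc 0 T, t ∈ Ioo 0 S := fun t ht => ⟨ht.1, ht.2.trans_lt hTS⟩
  have hslice : ∀ t ∈ Ioc 0 T, ContinuousOn (fun x => Φ (x, t)) O := fun t ht =>
    hΦ.continuousOn.comp (by fun_prop) fun x hx => ⟨hx, hmem t ht⟩
  have htsup : ∀ f : E → ℂ, Function.support f ⊆ K → tsupport f ⊆ K := fun f hf =>
    closure_minimal hf K.isCompact.isClosed
  obtain ⟨A, L, hA, hAL⟩ := ContDiffMapSupportedIn.exists_uniform_bound μ K (ι := Ioc 0 T)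
    (fun t x => Φ (x, t))
    (fun t => ((hslice t t.2).mono hK).integrableOn_compact K.isCompact) (by
      intro g
      have hgK : tsupport g ⊆ O := g.tsupport_subset.trans hK
      let f : TestFn E := TestFunction.ofSupportedIn (subset_univ _) g
      have hcont : ContinuousOn (fun t => ∫ x, Φ (x, t) * g x ∂μ) (Ioc 0 T) := fun t ht =>
        (hasDerivAt_integral_mul_of_fderiv_eq hO hΦ hCR (g' := fun x => fderiv ℝ g x y)
          g.continuous ((g.contDiff.continuous_fderiv (by simp)).clm_apply continuous_const)
          g.hasCompactSupport hgK
          (fun x => ((g.contDiff.differentiable (by simp)) x).hasFDerivAt.hasLineDerivAt y)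
          (hmem t ht)).continuousAt.continuousWithinAt
      -- Pointwise boundedness: near `t = 0` by convergence to `ψ f`, on the remaining compact
      -- interval by continuity.
      have h0 : ∀ᶠ t in 𝓝[>] (0 : ℝ), ‖∫ x, Φ (x, t) * g x ∂μ‖ < ‖ψ f‖ + 1 :=
        (hlim f hgK).norm.eventually_lt_const (by linarith)
      obtain ⟨δ, hδ, hδ'⟩ := mem_nhdsGT_iff_exists_Ioc_subset.1 h0
      obtain ⟨C, hC⟩ := (isCompact_Icc (a := δ) (b := T)).exists_bound_of_continuousOn
        (hcont.mono fun t ht => ⟨lt_of_lt_of_le hδ ht.1, ht.2⟩)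
      refine ⟨max (‖ψ f‖ + 1) C, fun t => ?_⟩
      rcases le_total (t : ℝ) δ with h | h
      · exact (le_of_lt (hδ' ⟨t.2.1, h⟩)).trans (le_max_left _ _)
      · exact (hC t ⟨h, t.2.2⟩).trans (le_max_right _ _))
  refine ⟨A, L, hA, fun f hf B hB hfB => ?_⟩
  have h1 : ∀ t ∈ Ioc 0 T, ‖∫ x, Φ (x, t) * f x ∂μ‖ ≤ A * B := fun t ht =>
    hAL ⟨t, ht⟩ (ContDiffMapSupportedIn.of_support_subset f.contDiff hf) B hB hfB
  refine ⟨h1, le_of_tendsto (hlim f ((htsup f hf).trans hK)).norm ?_⟩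
  filter_upwards [Ioc_mem_nhdsGT hT] with t ht using h1 t ht

/-- Exponential weights turn the Fourier–Laplace integrals of `Φ` into an Appell-type sequence. -/
theorem hasDerivAt_exp_mul_integral_planeWave (hO : IsOpen O)
    (hΦ : ContDiffOn ℝ 1 Φ (O ×ˢ Ioo 0 S))
    (hCR : ∀ p ∈ O ×ˢ Ioo 0 S, fderiv ℝ Φ p (0, 1) = Complex.I * fderiv ℝ Φ p (y, 0))
    {χ χ' : E → ℂ} (hχ : Continuous χ) (hχ' : Continuous χ') (hc : HasCompactSupport χ)
    (hc' : HasCompactSupport χ') (hχO : tsupport χ ⊆ O) (hχO' : tsupport χ' ⊆ O)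
    (hχχ' : ∀ x, HasLineDerivAt ℝ χ (χ' x) x y) (k : E) {s : ℝ} (hs : s ∈ Ioo 0 S) :
    HasDerivAt
      (fun s : ℝ => Complex.exp ((s * inner ℝ k y : ℝ) : ℂ) *
        ∫ x, Φ (x, s) * (χ x * (planeWave k : E → ℂ) x) ∂μ)
      (-(Complex.I * (Complex.exp ((s * inner ℝ k y : ℝ) : ℂ) *
        ∫ x, Φ (x, s) * (χ' x * (planeWave k : E → ℂ) x) ∂μ))) s := by
  have hpc : Continuous (planeWave k : E → ℂ) := (show ContDiff ℝ ∞ _ from (planeWave k).2).continuous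
  set κ : ℂ := ((inner ℝ k y : ℝ) : ℂ) with hκ
  have hslice : ContinuousOn (fun x => Φ (x, s)) O :=
    hΦ.continuousOn.comp (by fun_prop) fun x hx => ⟨hx, hs⟩
  have hint : ∀ χ : E → ℂ, Continuous χ → HasCompactSupport χ → tsupport χ ⊆ O →
      Integrable (fun x => Φ (x, s) * (χ x * (planeWave k : E → ℂ) x)) μ := fun χ h1 h2 h3 =>
    hslice.integrable_mul_of_tsupport_subset hO (h1.mul hpc) h2.mul_right
      ((tsupport_mul_subset_left).trans h3)
  have hΛ := hasDerivAt_integral_mul_of_fderiv_eq (μ := μ) hO hΦ hCR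
    (g := fun x => χ x * (planeWave k : E → ℂ) x)
    (g' := fun x => χ' x * (planeWave k : E → ℂ) x -
      Complex.I * κ * (χ x * (planeWave k : E → ℂ) x))
    (hχ.mul hpc) ((hχ'.mul hpc).sub (continuous_const.mul (hχ.mul hpc))) hc.mul_right
    ((tsupport_mul_subset_left).trans hχO) (fun x => by
      have h := HasDerivAt.mul (hχχ' x : HasDerivAt _ _ _)
        (hasLineDerivAt_planeWave k x y : HasDerivAt _ _ _)
      refine HasDerivAt.congr_deriv h ?_
      simp only [zero_smul, add_zero]
      ring) hs
  have hsplit : ∫ x, Φ (x, s) * (χ' x * (planeWave k : E → ℂ) x -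
      Complex.I * κ * (χ x * (planeWave k : E → ℂ) x)) ∂μ =
      ∫ x, Φ (x, s) * (χ' x * (planeWave k : E → ℂ) x) ∂μ -
        Complex.I * κ * ∫ x, Φ (x, s) * (χ x * (planeWave k : E → ℂ) x) ∂μ := by
    rw [← integral_const_mul, ← integral_sub (hint χ' hχ' hc' hχO')
      ((hint χ hχ hc hχO).const_mul _)]
    refine integral_congr_ae (Eventually.of_forall fun x => ?_)
    simp only
    ring
  rw [hsplit] at hΛ
  have hexp : HasDerivAt (fun s : ℝ => Complex.exp ((s * inner ℝ k y : ℝ) : ℂ))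
      (Complex.exp ((s * inner ℝ k y : ℝ) : ℂ) * κ) s := by
    have h1 : HasDerivAt (fun s : ℝ => ((s * inner ℝ k y : ℝ) : ℂ)) κ s := by
      simpa using! ((hasDerivAt_id s).mul_const (inner ℝ k y)).ofReal_comp
    exact h1.cexp
  refine (hexp.mul hΛ).congr_deriv ?_
  -- The derivative of the plane wave contributes `-(k·y)` times the integral, which the derivative
  -- of the exponential weight cancels.
  have hI : Complex.I * Complex.I = -1 := Complex.I_mul_I
  linear_combination (Complex.exp ((s * inner ℝ k y : ℝ) : ℂ) * κ *
    ∫ x, Φ (x, s) * (χ x * (planeWave k : E → ℂ) x) ∂μ) * hI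

end

/-! ### Decay of the localized Fourier transform -/

section

variable {E : Type*} [NormedAddCommGroup E] [InnerProductSpace ℝ E]
  [FiniteDimensional ℝ E] [MeasurableSpace E] [BorelSpace E] {μ : Measure E}
  [μ.IsAddHaarMeasure] {ψ : CDistribution E} {O : Set E} {S : ℝ} {y : E} {Φ : E × ℝ → ℂ}

/-- The Taylor estimate, applied to the Fourier transform of a localized boundary value. -/
theorem norm_boundaryValue_planeWave_le (hO : IsOpen O) (hΦ : ContDiffOn ℝ 1 Φ (O ×ˢ Ioo 0 S))
    (hCR : ∀ p ∈ O ×ˢ Ioo 0 S, fderiv ℝ Φ p (0, 1) = Complex.I * fderiv ℝ Φ p (y, 0))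
    {χ : ℕ → E → ℂ} (hχ : ∀ j, ContDiff ℝ ∞ (χ j)) (hc : ∀ j, HasCompactSupport (χ j))
    (hχO : ∀ j, tsupport (χ j) ⊆ O) (hχχ : ∀ j x, HasLineDerivAt ℝ (χ j) (χ (j + 1) x) x y)
    {k : E} {c' : ℝ} (hk : 0 < c' * ‖k‖) (hky : inner ℝ k y ≤ -(c' * ‖k‖)) {R q T : ℝ} (hR : 0 ≤ R)
    (hq : 0 ≤ q) (hT : 0 < T) (hTS : 2 * T < S) (n : ℕ)
    (hbound : ∀ j ≤ n + 1, ∀ t ∈ Ioc 0 (2 * T),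
      ‖∫ x, Φ (x, t) * (χ j x * (planeWave k : E → ℂ) x) ∂μ‖ ≤ R * q ^ j)
    {w : ℂ} (hw : Tendsto (fun t => ∫ x, Φ (x, t) * (χ 0 x * (planeWave k : E → ℂ) x) ∂μ)
      (𝓝[>] 0) (𝓝 w)) :
    ‖w‖ ≤ R * (Real.exp (-(c' * ‖k‖ * T)) * Real.exp (T * q) + q ^ (n + 1) * (c' * ‖k‖)⁻¹ ^ n * T) := by
  set m : ℕ → ℝ → ℂ := fun j s => Complex.exp ((s * inner ℝ k y : ℝ) : ℂ) *
    ∫ x, Φ (x, s) * (χ j x * (planeWave k : E → ℂ) x) ∂μ with hm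
  have hderiv : ∀ j, ∀ s ∈ Ioo 0 S, HasDerivAt (m j) (-(Complex.I * m (j + 1) s)) s := fun j s hs =>
    hasDerivAt_exp_mul_integral_planeWave hO hΦ hCR (hχ j).continuous (hχ (j + 1)).continuous (hc j)
      (hc (j + 1)) (hχO j) (hχO (j + 1)) (hχχ j) k hs
  have hmb : ∀ j ≤ n + 1, ∀ t ∈ Ioc 0 (2 * T),
      ‖m j t‖ ≤ Real.exp (-(c' * ‖k‖ * t)) * (R * q ^ j) := by
    intro j hj t ht
    simp only [hm, norm_mul, Complex.norm_exp, Complex.ofReal_re]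
    gcongr
    · nlinarith [ht.1]
    · exact hbound j hj t ht
  -- The bound does not depend on `τ`, so it survives `τ ↓ 0`. The points used are at most `τ + T <
  -- 2T`, which stays in the range of `hbound`.
  have hτ : ∀ τ ∈ Ioo 0 T, ‖m 0 τ‖ ≤
      R * (Real.exp (-(c' * ‖k‖ * T)) * Real.exp (T * q) + q ^ (n + 1) * (c' * ‖k‖)⁻¹ ^ n * T) := by
    intro τ hτ
    refine (norm_le_taylor hderiv n hτ.1 hT.le (by linarith [hτ.2])
      (B := R * q ^ (n + 1) * (c' * ‖k‖)⁻¹ ^ n) fun s hs0 hsT => ?_).trans ?_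
    · have h1 := hmb (n + 1) le_rfl (τ + s) ⟨by linarith [hτ.1], by linarith [hτ.2]⟩
      have h2 : Real.exp (-(c' * ‖k‖ * (τ + s))) ≤ Real.exp (-(c' * ‖k‖ * s)) := by
        gcongr
        linarith [hτ.1]
      calc s ^ n / n.factorial * ‖m (n + 1) (τ + s)‖
          ≤ s ^ n / n.factorial * (Real.exp (-(c' * ‖k‖ * s)) * (R * q ^ (n + 1))) := by
            gcongr
            exact h1.trans (by gcongr)
        _ = R * q ^ (n + 1) * (s ^ n / n.factorial * Real.exp (-(c' * ‖k‖ * s))) := by ring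
        _ ≤ _ := by
            gcongr
            exact pow_div_factorial_mul_exp_neg_le hs0 hk n
    · have h1 : ∀ j ∈ Finset.range (n + 1), T ^ j / j.factorial * ‖m j (τ + T)‖ ≤
          R * Real.exp (-(c' * ‖k‖ * T)) * ((T * q) ^ j / j.factorial) := by
        intro j hj
        have h2 := hmb j (Finset.mem_range.1 hj).le (τ + T) ⟨by linarith [hτ.1], by linarith [hτ.2]⟩
        have h3 : Real.exp (-(c' * ‖k‖ * (τ + T))) ≤ Real.exp (-(c' * ‖k‖ * T)) := by
          gcongr
          linarith [hτ.1]
        calc _ ≤ T ^ j / j.factorial * (Real.exp (-(c' * ‖k‖ * T)) * (R * q ^ j)) := by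
              gcongr
              exact h2.trans (by gcongr)
          _ = _ := by rw [mul_pow]; ring
      have h4 := Finset.sum_le_sum h1
      rw [← Finset.mul_sum] at h4
      have h5 := Real.sum_le_exp_of_nonneg (mul_nonneg hT.le hq) (n + 1)
      have h6 : R * Real.exp (-(c' * ‖k‖ * T)) * ∑ j ∈ Finset.range (n + 1), (T * q) ^ j / j.factorial
          ≤ R * Real.exp (-(c' * ‖k‖ * T)) * Real.exp (T * q) := by gcongr
      linarith
  have hlim : Tendsto (m 0) (𝓝[>] 0) (𝓝 w) := by
    have hexp : Tendsto (fun s : ℝ => Complex.exp ((s * inner ℝ k y : ℝ) : ℂ)) (𝓝[>] 0) (𝓝 1) := by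
      have : Continuous fun s : ℝ => Complex.exp ((s * inner ℝ k y : ℝ) : ℂ) := by fun_prop
      simpa using (this.tendsto 0).mono_left nhdsWithin_le_nhds
    simpa [hm] using hexp.mul hw
  refine le_of_tendsto hlim.norm ?_
  filter_upwards [Ioo_mem_nhdsGT hT] with τ h using hτ τ h

/-- A boundary value from the direction `y` is analytically regular in all directions `k₀` with
`k₀ · y < 0`. -/
theorem isAnalyticRegular_of_boundaryValue {x₀ k₀ : E} (hk₀ : inner ℝ k₀ y < 0) (hx₀ : x₀ ∈ O)
    (hS : 0 < S) (hO : IsOpen O) (hΦ : ContDiffOn ℝ 1 Φ (O ×ˢ Ioo 0 S))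
    (hCR : ∀ p ∈ O ×ˢ Ioo 0 S, fderiv ℝ Φ p (0, 1) = Complex.I * fderiv ℝ Φ p (y, 0))
    (hlim : ∀ f : TestFn E, tsupport f ⊆ O →
      Tendsto (fun t => ∫ x, Φ (x, t) * f x ∂μ) (𝓝[>] 0) (𝓝 (ψ f))) :
    IsAnalyticRegular ψ x₀ k₀ := by
  have hy : y ≠ 0 := by rintro rfl; simp at hk₀
  have hk₀0 : 0 < ‖k₀‖ := norm_pos_iff.2 (by rintro rfl; simp at hk₀)
  -- The factor `2` makes `k·y < -c'‖k‖` strict at `k₀`, hence valid on an open cone.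
  set c' : ℝ := -inner ℝ k₀ y / (2 * ‖k₀‖) with hc'
  have hc'0 : 0 < c' := div_pos (by linarith) (by linarith)
  obtain ⟨V, K, c, B, hV, hx₀V, hKO, hc, hcut⟩ := exists_directional_cutoff hy (hO.mem_nhds hx₀)
  have hT : 0 < S / 4 := by linarith
  obtain ⟨A, L, hA, hbound⟩ := exists_boundaryValue_bound hO hΦ hCR hlim K hKO
    (T := 2 * (S / 4)) (by linarith) (by linarith)
  -- The Taylor argument is run with `n = N + L`, to beat `‖k‖^N` and the `‖k‖^L` from the seminorms
  -- of the plane wave; its remainder uses `χ (n + 1)`.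
  choose! χ hχ hχK hχ1 hχχ hχB using fun N : ℕ => hcut (N + L + 1) (Nat.le_add_left 1 _)
  have htsup : ∀ N j, tsupport (χ N j) ⊆ K := fun N j =>
    closure_minimal (hχK N j) K.isCompact.isClosed
  have hcs : ∀ N j, HasCompactSupport (χ N j) := fun N j =>
    HasCompactSupport.of_support_subset_isCompact K.isCompact (hχK N j)
  set b : ℝ := ∑ i ∈ Finset.range (L + 1), |B i| with hb
  have hb0 : 0 ≤ b := Finset.sum_nonneg fun _ _ => abs_nonneg _
  have hBb : ∀ i ≤ L, B i ≤ b := fun i hi => (le_abs_self _).trans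
    (Finset.single_le_sum (f := fun i => |B i|) (fun _ _ => abs_nonneg _)
      (Finset.mem_range.2 (Nat.lt_succ_of_le hi)))
  have hχb : ∀ N, ∀ i ≤ L, ∀ j ≤ N + L + 1, ∀ x,
      ‖iteratedFDeriv ℝ i (χ N j) x‖ ≤ b * (c * (N + L + 1 : ℕ)) ^ j := fun N i hi j hj x =>
    (hχB N i j hj x).trans (by gcongr; exact hBb i hi)
  -- the seminorms of a localized smooth function
  have hprod : ∀ N, ∀ j ≤ N + L + 1, ∀ (f : SmoothFn E) (P : ℝ), 0 ≤ P →
      (∀ i ≤ L, ∀ x ∈ (K : Set E), ‖iteratedFDeriv ℝ i (f : E → ℂ) x‖ ≤ P) →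
      ∀ i ≤ L, ∀ x, ‖iteratedFDeriv ℝ i (SmoothFn.cutoff (χ N j) (hχ N j) (hcs N j) f) x‖ ≤
        2 ^ L * (b * (c * (N + L + 1 : ℕ)) ^ j * P) := by
    intro N j hj f P hP hf i hi x
    -- Outside `K` the localized function has vanishing derivatives, so `f` need only be controlled
    -- on `K`.
    by_cases hx : x ∈ (K : Set E)
    · refine (norm_iteratedFDeriv_mul_le_of_le (hχ N j) f.2
        (fun q hq => hχb N q (hq.trans hi) j hj x) (fun q hq => hf q (hq.trans hi) x hx)).trans ?_
      gcongr
      norm_num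
    · have h0 : iteratedFDeriv ℝ i (SmoothFn.cutoff (χ N j) (hχ N j) (hcs N j) f) x = 0 := by
        by_contra h
        refine hx (htsup N j (tsupport_mul_subset_left (g := (f : E → ℂ)) ?_))
        exact support_iteratedFDeriv_subset i h
      rw [h0, norm_zero]
      positivity
  have hsupp : ∀ N j (f : SmoothFn E),
      Function.support (SmoothFn.cutoff (χ N j) (hχ N j) (hcs N j) f) ⊆ K := fun N j f x hx =>
    hχK N j (left_ne_zero_of_mul hx)
  have hwave : ∀ N, ∀ j ≤ N + L + 1, ∀ (k : E) (P : ℝ), 0 ≤ P → (∀ i ≤ L, ‖k‖ ^ i ≤ P) →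
      (∀ t ∈ Ioc 0 (2 * (S / 4)), ‖∫ x, Φ (x, t) * (χ N j x * (planeWave k : E → ℂ) x) ∂μ‖ ≤
        A * (2 ^ L * (b * (c * (N + L + 1 : ℕ)) ^ j * P))) ∧
      ‖ψ (SmoothFn.cutoff (χ N j) (hχ N j) (hcs N j) (planeWave k))‖ ≤
        A * (2 ^ L * (b * (c * (N + L + 1 : ℕ)) ^ j * P)) := fun N j hj k P hP hkP =>
    hbound _ (hsupp N j _) _ (by positivity) (hprod N j hj (planeWave k) P hP fun i hi x _ =>
      (norm_iteratedFDeriv_planeWave_le k i x).trans (hkP i hi))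
  obtain ⟨Q, hQ1, hQ⟩ := exists_const_analytic_decay hc hc'0 hT
  obtain ⟨C, hC1, hC⟩ := exists_const_pow_shift (A * (2 ^ L * b) * (1 + S / 4)) Q (by positivity)
    hQ1 L
  refine ⟨V, hV, hx₀V, {k | inner ℝ k y < -(c' * ‖k‖)}, isOpen_lt (by fun_prop) (by fun_prop), ?_, ?_,
    fun N => ψ.toLinearMap ∘ₗ SmoothFn.cutoff (χ N 0) (hχ N 0) (hcs N 0), ?_, ?_, C, ?_⟩
  · change inner ℝ k₀ y < -(c' * ‖k₀‖)
    have : c' * ‖k₀‖ = -inner ℝ k₀ y / 2 := by rw [hc']; field_simp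
    linarith
  · intro k hk t ht
    change inner ℝ (t • k) y < -(c' * ‖t • k‖)
    rw [real_inner_smul_left, norm_smul, Real.norm_of_nonneg ht.le]
    have := mul_lt_mul_of_pos_left (show inner ℝ k y < -(c' * ‖k‖) from hk) ht
    linarith
  · refine ⟨K, A * (2 ^ L * b), L, K.isCompact, fun N f => ?_⟩
    set P : ℝ := ∑ j ∈ Finset.range (L + 1),
      sSup ((fun x => ‖iteratedFDeriv ℝ j (f : E → ℂ) x‖) '' K) with hP
    have hnn : ∀ j, 0 ≤ sSup ((fun x => ‖iteratedFDeriv ℝ j (f : E → ℂ) x‖) '' K) := fun j =>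
      Real.sSup_nonneg (by rintro _ ⟨x, -, rfl⟩; exact norm_nonneg _)
    have hP0 : 0 ≤ P := Finset.sum_nonneg fun j _ => hnn j
    have hfP : ∀ i ≤ L, ∀ x ∈ (K : Set E), ‖iteratedFDeriv ℝ i (f : E → ℂ) x‖ ≤ P := by
      intro i hi x hx
      have hcont : Continuous fun x => ‖iteratedFDeriv ℝ i (f : E → ℂ) x‖ :=
        ((show ContDiff ℝ ∞ (f : E → ℂ) from f.2).continuous_iteratedFDeriv
          (by exact_mod_cast le_top)).norm
      refine (le_csSup (K.isCompact.image hcont).bddAbove (mem_image_of_mem _ hx)).trans ?_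
      exact Finset.single_le_sum
        (f := fun j => sSup ((fun x => ‖iteratedFDeriv ℝ j (f : E → ℂ) x‖) '' K))
        (fun j _ => hnn j) (Finset.mem_range.2 (Nat.lt_succ_of_le hi))
    have h := (hbound _ (hsupp N 0 f) _ (by positivity)
      (hprod N 0 (Nat.zero_le _) f P hP0 hfP)).2
    refine h.trans (le_of_eq ?_)
    ring
  · intro N f hf
    change ψ _ = ψ f
    congr 1
    ext x
    rw [SmoothFn.cutoff_apply]
    change χ N 0 x * f x = f x
    by_cases hx : f x = 0
    · rw [hx, mul_zero]
    · rw [hχ1 N x (hf (subset_tsupport _ hx)), one_mul]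
  · intro N k hk
    change ‖k‖ ^ N * ‖ψ (SmoothFn.cutoff (χ N 0) (hχ N 0) (hcs N 0) (planeWave k))‖ ≤ _
    have hk0 : 0 < ‖k‖ := norm_pos_iff.2 (by rintro rfl; simp at hk)
    refine le_trans ?_ (hC N)
    have hcast : (1 : ℝ) ≤ (N + L + 1 : ℕ) := by exact_mod_cast Nat.le_add_left 1 _
    -- For `‖k‖ ≤ 1` the seminorm bound suffices; for `‖k‖ ≥ 1` all powers up to order `L` are
    -- dominated by `‖k‖^L`.
    rcases le_total ‖k‖ 1 with h1 | h1
    · have h2 := (hwave N 0 (Nat.zero_le _) k 1 zero_le_one fun i _ => pow_le_one₀ hk0.le h1).2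
      have h3 : 1 ≤ (1 + S / 4) * (Q * (N + L + 1 : ℕ)) ^ (N + L + 1) :=
        one_le_mul_of_one_le_of_one_le (by linarith)
          (one_le_pow₀ (one_le_mul_of_one_le_of_one_le hQ1 hcast))
      calc _ ≤ 1 * (A * (2 ^ L * (b * (c * (N + L + 1 : ℕ)) ^ 0 * 1))) := by
            gcongr
            exact pow_le_one₀ hk0.le h1
        _ = A * (2 ^ L * b) * 1 := by ring
        _ ≤ A * (2 ^ L * b) * ((1 + S / 4) * (Q * (N + L + 1 : ℕ)) ^ (N + L + 1)) := by gcongr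
        _ = _ := by ring
    · have h2 := fun j hj => (hwave N j hj k (‖k‖ ^ L) (by positivity)
        fun i hi => pow_le_pow_right₀ h1 hi).1
      have h3 := norm_boundaryValue_planeWave_le (μ := μ) hO hΦ hCR (hχ N) (hcs N)
        (fun j => (htsup N j).trans hKO) (hχχ N) (mul_pos hc'0 hk0) (le_of_lt hk)
        (R := A * (2 ^ L * b) * ‖k‖ ^ L) (q := c * (N + L + 1 : ℕ)) (by positivity) (by positivity)
        hT (by linarith) (N + L)
        (fun j hj t ht => (h2 j hj t ht).trans (le_of_eq (by ring)))
        (hlim (SmoothFn.cutoff (χ N 0) (hχ N 0) (hcs N 0) (planeWave k))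
          ((closure_minimal (hsupp N 0 _) K.isCompact.isClosed).trans hKO))
      calc _ ≤ ‖k‖ ^ N * (A * (2 ^ L * b) * ‖k‖ ^ L * (Real.exp (-(c' * ‖k‖ * (S / 4))) *
              Real.exp (S / 4 * (c * (N + L + 1 : ℕ))) +
              (c * (N + L + 1 : ℕ)) ^ (N + L + 1) * (c' * ‖k‖)⁻¹ ^ (N + L) * (S / 4))) := by gcongr
        _ = A * (2 ^ L * b) * (‖k‖ ^ (N + L) * (Real.exp (-(c' * ‖k‖ * (S / 4))) *
              Real.exp (S / 4 * (c * (N + L + 1 : ℕ))) +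
              (c * (N + L + 1 : ℕ)) ^ (N + L + 1) * (c' * ‖k‖)⁻¹ ^ (N + L) * (S / 4))) := by
            rw [pow_add ‖k‖]; ring
        _ ≤ A * (2 ^ L * b) * ((1 + S / 4) * (Q * (N + L + 1 : ℕ)) ^ (N + L + 1)) := by
            exact mul_le_mul_of_nonneg_left (hQ (N + L) ‖k‖ hk0) (by positivity)
        _ = _ := by ring

end

/-! ### Boundary values from the forward tube -/

/-- The complexified translate `(x, t) ↦ x + i t y`. -/
def tubeMap {n m : ℕ} (y : Fin m × Fin n → ℝ) : Conf n m × ℝ →L[ℝ] (Fin m × Fin n → ℂ) :=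
  ContinuousLinearMap.pi fun p =>
    Complex.ofRealCLM ∘L (EuclideanSpace.proj p : Conf n m →L[ℝ] ℝ) ∘L
      ContinuousLinearMap.fst ℝ (Conf n m) ℝ +
    (Complex.I * (y p : ℂ)) • (Complex.ofRealCLM ∘L ContinuousLinearMap.snd ℝ (Conf n m) ℝ)

theorem tubeMap_apply {n m : ℕ} (y : Fin m × Fin n → ℝ) (x : Conf n m) (t : ℝ) :
    tubeMap y (x, t) = fun p => (x p : ℂ) + Complex.I * ((t * y p : ℝ) : ℂ) := by
  ext p
  simp [tubeMap]
  ring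

section Tube

variable {n : ℕ} [NeZero n]

theorem sum_minkowskiMetric_mul_mul (x v : Fin n → ℝ) :
    ∑ μ, ∑ ν, minkowskiMetric n x μ ν * v μ * v ν =
      v 0 ^ 2 - ∑ μ ∈ Finset.univ.erase 0, v μ ^ 2 := by
  have h1 : ∀ μ, ∑ ν, minkowskiMetric n x μ ν * v μ * v ν = (if μ = 0 then 1 else -1) * v μ ^ 2 := by
    intro μ
    rw [Finset.sum_eq_single μ]
    · simp only [minkowskiMetric, Matrix.diagonal_apply_eq]; ring
    · intro ν _ h
      simp [minkowskiMetric, Matrix.diagonal_apply_ne' _ h]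
    · simp
  simp only [h1]
  rw [← Finset.add_sum_erase _ _ (Finset.mem_univ 0), if_pos rfl, one_mul, sub_eq_add_neg,
    ← Finset.sum_neg_distrib]
  congr 1
  refine Finset.sum_congr rfl fun μ hμ => ?_
  rw [if_neg (Finset.ne_of_mem_erase hμ)]
  ring

theorem mem_forwardCone_iff {v : Fin n → ℝ} :
    v ∈ forwardCone n ↔ 0 < v 0 ∧ ∑ μ ∈ Finset.univ.erase 0, v μ ^ 2 < v 0 ^ 2 := by
  rw [forwardCone, mem_ofPred_eq, sum_minkowskiMetric_mul_mul, sub_pos]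

theorem smul_mem_forwardCone {v : Fin n → ℝ} (hv : v ∈ forwardCone n) {t : ℝ} (ht : 0 < t) :
    t • v ∈ forwardCone n := by
  rw [mem_forwardCone_iff] at hv ⊢
  simp only [Pi.smul_apply, smul_eq_mul, mul_pow, ← Finset.mul_sum]
  exact ⟨mul_pos ht hv.1, mul_lt_mul_of_pos_left hv.2 (by positivity)⟩

theorem single_mem_forwardCone {ε : ℝ} (hε : 0 < ε) : Pi.single 0 ε ∈ forwardCone n := by
  rw [mem_forwardCone_iff]
  refine ⟨by simpa using hε, ?_⟩
  rw [Finset.sum_eq_zero fun μ hμ => by simp [Finset.ne_of_mem_erase hμ]]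
  simpa using pow_pos hε 2

theorem single_add_mem_forwardCone {ε : ℝ} (hε : 0 < ε) {v : Fin n → ℝ} (hv : v ∈ forwardCone n) :
    Pi.single 0 ε + v ∈ forwardCone n := by
  rw [mem_forwardCone_iff] at hv ⊢
  simp only [Pi.add_apply, Pi.single_eq_same]
  rw [Finset.sum_congr rfl fun μ hμ => by
    rw [Pi.single_eq_of_ne (Finset.ne_of_mem_erase hμ), zero_add]]
  exact ⟨by linarith [hv.1], by nlinarith [hv.1, hv.2]⟩

theorem smul_mem_tubeCone {m : ℕ} {y : Fin m × Fin n → ℝ} (hy : y ∈ tubeCone n m) {t : ℝ}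
    (ht : 0 < t) : t • y ∈ tubeCone n m := fun j h => by
  have := smul_mem_forwardCone (hy j h) ht
  convert! this using 1
  ext μ
  simp [mul_sub]

/-- Near `(x₀, 0)` the points `x + ity` with `t > 0` lie in the tube and in `Z`, and the complex
linearity of the derivative of `F` is the required Cauchy–Riemann equation. -/
theorem isAnalyticRegular_of_isTubeBoundaryValue {m : ℕ} {ψ : CDistribution (Conf n m)}
    (hψ : IsTubeBoundaryValue n m ψ) {x₀ k₀ : Conf n m} {y : Fin m × Fin n → ℝ}
    (hy : y ∈ tubeCone n m) (hk : inner ℝ k₀ (WithLp.toLp 2 y : Conf n m) < 0) :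
    IsAnalyticRegular ψ x₀ k₀ := by
  obtain ⟨Z, hZ, hZr, F, hF, hlim⟩ := hψ
  have hpre : tubeMap y ⁻¹' Z ∈ 𝓝 (x₀, (0 : ℝ)) := by
    refine (hZ.preimage (tubeMap y).continuous).mem_nhds ?_
    rw [mem_preimage, tubeMap_apply]
    simpa using hZr x₀
  rw [nhds_prod_eq] at hpre
  obtain ⟨O', hO', T, hT, hsub⟩ := Filter.mem_prod_iff.1 hpre
  obtain ⟨O, hOO', hO, hx₀⟩ := mem_nhds_iff.1 hO'
  obtain ⟨S, hS, hST⟩ := Metric.mem_nhds_iff.1 hT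
  have hdom : ∀ p ∈ O ×ˢ Ioo 0 S, tubeMap y p ∈ forwardTube n m ∩ Z := by
    rintro ⟨x, t⟩ ⟨hx, ht⟩
    refine ⟨?_, hsub ⟨hOO' hx, hST ?_⟩⟩
    · have h := smul_mem_tubeCone hy ht.1
      rw [tubeMap_apply, forwardTube, mem_ofPred_eq]
      convert! h using 1
      ext p
      simp
    · simpa [abs_of_pos ht.1] using ht.2
  have hFd : ∀ p ∈ O ×ˢ Ioo 0 S, HasFDerivAt (fun p => F (tubeMap y p))
      (((fderiv ℂ F (tubeMap y p)).restrictScalars ℝ).comp (tubeMap y)) p := fun p hp =>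
    (((hF _ (hdom p hp)).differentiableAt.hasFDerivAt).restrictScalars ℝ).comp p
      (tubeMap y).hasFDerivAt
  refine isAnalyticRegular_of_boundaryValue (μ := volume) (O := O) (S := S)
    (y := WithLp.toLp 2 y) (Φ := fun p => F (tubeMap y p)) hk hx₀ hS hO ?_ ?_ ?_
  · intro p hp
    exact ((((hF _ (hdom p hp)).contDiffAt (n := 1)).restrict_scalars ℝ).comp p
      (tubeMap y).contDiff.contDiffAt).contDiffWithinAt
  · intro p hp
    rw [(hFd p hp).fderiv]
    change fderiv ℂ F (tubeMap y p) (tubeMap y (0, 1)) =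
      Complex.I * fderiv ℂ F (tubeMap y p) (tubeMap y (WithLp.toLp 2 y, 0))
    rw [← smul_eq_mul, ← map_smul]
    congr 1
    rw [tubeMap_apply, tubeMap_apply]
    ext p
    simp
  · intro f _
    simp only [tubeMap_apply]
    exact hlim y hy f

end Tube

/-! ### The dual of the tube cone -/

section Tail

/-- The momentum carried by the points following the `j`-th one. -/
def tailMomentum {n m : ℕ} (k : Conf n m) (j : Fin m) (μ : Fin n) : ℝ :=
  ∑ l, if j < l then k (l, μ) else 0

/-- Consecutive tail sums differ by one momentum. The first vertex has no predecessor, and there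
total momentum zero takes the place of the missing term. -/
theorem tailMomentum_telescope {n m : ℕ} {k : Conf n m} (hk : ∀ μ, ∑ l, k (l, μ) = 0) (i : Fin m) (μ : Fin n) :
    k (i, μ) = (∑ j : Fin m, if (j : ℕ) + 1 = i then tailMomentum k j μ else 0) - tailMomentum k i μ := by
  have hsum : ∀ c : Fin m → ℝ, ∑ l, (if l = i then c l else 0) = c i := fun c => by simp
  rcases Nat.eq_zero_or_pos (i : ℕ) with h0 | hpos
  · rw [Finset.sum_eq_zero fun j _ => if_neg (by omega), zero_sub, eq_neg_iff_add_eq_zero, ← hk μ,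
      ← hsum fun l => k (l, μ), tailMomentum, ← Finset.sum_add_distrib]
    refine Finset.sum_congr rfl fun l _ => ?_
    have h1 : l = i ↔ ¬ i < l := by rw [Fin.lt_def, Fin.ext_iff]; omega
    by_cases h : i < l <;> simp [h1, h]
  · let i' : Fin m := ⟨i - 1, by omega⟩
    rw [Finset.sum_eq_single i' (fun j _ hj => if_neg fun h => hj (Fin.ext (by simp [i']; omega)))
      (by simp), if_pos (by simp [i']; omega), ← hsum fun l => k (l, μ), tailMomentum, tailMomentum,
      ← Finset.sum_sub_distrib]
    refine Finset.sum_congr rfl fun l _ => ?_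
    have h1 : l = i ↔ i' < l ∧ ¬ i < l := by
      rw [Fin.lt_def, Fin.lt_def, Fin.ext_iff]; simp [i']; omega
    have h2 : i < l → i' < l := by rw [Fin.lt_def, Fin.lt_def]; simp [i']; omega
    by_cases h : i < l
    · simp [h1, h, h2 h]
    · simp [h1, h]

end Tail

section Dual

variable {n : ℕ} [NeZero n]

theorem nonneg_of_forall_pos_mul_add {a b : ℝ} (h : ∀ ε > 0, 0 ≤ ε * a + b) : 0 ≤ b := by
  have h1 : Tendsto (fun ε : ℝ => ε * a + b) (𝓝[>] 0) (𝓝 b) := by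
    have : Continuous fun ε : ℝ => ε * a + b := by fun_prop
    simpa using (this.tendsto 0).mono_left nhdsWithin_le_nhds
  exact ge_of_tendsto h1 (eventually_mem_nhdsWithin.mono fun ε hε => h ε hε)

/-- Covectors that are nonnegative on the forward cone are causal and future directed. -/
theorem sum_sq_le_of_nonneg_forwardCone {p : Fin n → ℝ}
    (hp : ∀ v ∈ forwardCone n, 0 ≤ ∑ μ, p μ * v μ) :
    0 ≤ p 0 ∧ ∑ μ ∈ Finset.univ.erase 0, p μ ^ 2 ≤ p 0 ^ 2 := by
  have h0 : 0 ≤ p 0 := by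
    have := hp _ (single_mem_forwardCone one_pos)
    simpa [Pi.single_apply] using this
  refine ⟨h0, ?_⟩
  set R : ℝ := ∑ μ ∈ Finset.univ.erase 0, p μ ^ 2 with hR
  have hR0 : 0 ≤ R := Finset.sum_nonneg fun μ _ => sq_nonneg _
  have hr := Real.sq_sqrt hR0
  have hr0 := Real.sqrt_nonneg R
  have key : 0 ≤ p 0 * √R - R := by
    refine nonneg_of_forall_pos_mul_add (a := p 0) fun ε hε => ?_
    -- The test vector points against the spatial part of `p`, just inside the light cone; `ε → 0`
    -- gives `R ≤ p 0 * √R`.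
    let v : Fin n → ℝ := fun μ => if μ = 0 then √R + ε else -p μ
    have hv0 : v 0 = √R + ε := if_pos rfl
    have hvμ : ∀ μ ∈ Finset.univ.erase (0 : Fin n), v μ = -p μ := fun μ hμ =>
      if_neg (Finset.ne_of_mem_erase hμ)
    have hv : v ∈ forwardCone n := by
      rw [mem_forwardCone_iff, hv0, Finset.sum_congr rfl fun μ hμ => by rw [hvμ μ hμ, neg_sq]]
      exact ⟨by linarith, by nlinarith⟩
    have h := hp v hv
    rw [← Finset.add_sum_erase _ _ (Finset.mem_univ 0), hv0,
      Finset.sum_congr rfl fun μ hμ => by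
        rw [hvμ μ hμ, show p μ * -p μ = -(p μ ^ 2) by ring], Finset.sum_neg_distrib] at h
    linarith
  rcases hr0.eq_or_lt with h | h
  · rw [← hr, ← h]; nlinarith
  · have : √R ≤ p 0 := by
      by_contra! hlt
      nlinarith
    rw [← hr]
    gcongr

variable {m : ℕ} {k : Conf n m}

/-- The cone constrains differences only, so it contains the whole line obtained by translating all
points of a configuration along `∂_μ`. A linear form that is nonnegative on a line has zero slope
there. -/
theorem sum_eq_zero_of_nonneg_tubeCone
    (hk : ∀ y ∈ tubeCone n m, 0 ≤ inner ℝ k (WithLp.toLp 2 y : Conf n m)) (μ : Fin n) :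
    ∑ l, k (l, μ) = 0 := by
  set a : ℝ := ∑ p : Fin m × Fin n, ((p.1 : ℕ) : ℝ) * (Pi.single 0 1 : Fin n → ℝ) p.2 * k p with ha
  have key : ∀ s : ℝ, 0 ≤ a + s * ∑ l, k (l, μ) := by
    intro s
    let y : Fin m × Fin n → ℝ := fun p =>
      ((p.1 : ℕ) : ℝ) * (Pi.single 0 1 : Fin n → ℝ) p.2 + s * (Pi.single μ 1 : Fin n → ℝ) p.2
    have hy : y ∈ tubeCone n m := fun j h => by
      have h1 := single_mem_forwardCone (n := n) one_pos
      convert! h1 using 1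
      ext ν
      simp only [y]
      push_cast
      ring
    have h := hk y hy
    have hs : ∑ p : Fin m × Fin n, s * (Pi.single μ 1 : Fin n → ℝ) p.2 * k p = s * ∑ l, k (l, μ) := by
      rw [Fintype.sum_prod_type, Finset.mul_sum]
      refine Finset.sum_congr rfl fun l _ => ?_
      simp [Pi.single_apply]
    rw [PiLp.inner_apply] at h
    simp only [y, RCLike.inner_apply, conj_trivial, add_mul, Finset.sum_add_distrib] at h
    rw [hs] at h
    exact h
  by_contra hne
  have h1 := key (-(a + 1) / ∑ l, k (l, μ))
  rw [div_mul_cancel₀ _ hne] at h1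
  linarith

/-- Test with the configuration that displaces all points after the `j`-th by `v`. Its other
successive differences vanish, so a small time ramp `ε · l` is added to enter the open cone, and `ε
→ 0`. -/
theorem tailMomentum_nonneg
    (hk : ∀ y ∈ tubeCone n m, 0 ≤ inner ℝ k (WithLp.toLp 2 y : Conf n m)) (j : Fin m)
    (v : Fin n → ℝ) (hv : v ∈ forwardCone n) : 0 ≤ ∑ μ, tailMomentum k j μ * v μ := by
  refine nonneg_of_forall_pos_mul_add
    (a := ∑ p : Fin m × Fin n, ((p.1 : ℕ) : ℝ) * (Pi.single 0 1 : Fin n → ℝ) p.2 * k p)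
    fun ε hε => ?_
  let y : Fin m × Fin n → ℝ := fun p =>
    ε * (((p.1 : ℕ) : ℝ) * (Pi.single 0 1 : Fin n → ℝ) p.2) + if j < p.1 then v p.2 else 0
  have hy : y ∈ tubeCone n m := fun i h => by
    by_cases hij : i = (j : ℕ)
    · have h1 := single_add_mem_forwardCone hε hv
      convert! h1 using 1
      ext ν
      have h2 : j < (⟨i + 1, h⟩ : Fin m) := by rw [Fin.lt_def]; simp [hij]
      have h3 : ¬ j < (⟨i, Nat.lt_of_succ_lt h⟩ : Fin m) := by rw [Fin.lt_def]; simp [hij]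
      simp only [y, if_pos h2, if_neg h3, Pi.add_apply, Pi.single_apply]
      push_cast
      split_ifs <;> ring
    · have h1 := single_mem_forwardCone (n := n) hε
      convert! h1 using 1
      ext ν
      have h2 : j < (⟨i + 1, h⟩ : Fin m) ↔ j < (⟨i, Nat.lt_of_succ_lt h⟩ : Fin m) := by
        rw [Fin.lt_def, Fin.lt_def]; simp only; omega
      simp only [y, h2, Pi.single_apply]
      push_cast
      split_ifs <;> ring
  have h := hk y hy
  rw [PiLp.inner_apply] at h
  simp only [y, RCLike.inner_apply, conj_trivial, add_mul, Finset.sum_add_distrib] at h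
  refine h.trans (le_of_eq ?_)
  rw [Finset.mul_sum]
  congr 1
  · exact Finset.sum_congr rfl fun p _ => by ring
  · rw [Fintype.sum_prod_type, Finset.sum_comm]
    refine Finset.sum_congr rfl fun μ _ => ?_
    rw [tailMomentum, Finset.sum_mul]
    refine Finset.sum_congr rfl fun l _ => ?_
    split_ifs <;> ring

end Dual

/-! ### The graph carrying the momenta -/

section Graph

variable {n m : ℕ}

theorem isPiecewiseSmooth_segment (a b : Fin n → ℝ) :
    IsPiecewiseSmooth fun t : ℝ => a + t • (b - a) := by
  have h : ContDiff ℝ ∞ fun t : ℝ => a + t • (b - a) :=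
    contDiff_const.add (contDiff_id.smul contDiff_const)
  exact ⟨h.continuous.continuousOn, ∅, fun _ _ _ _ _ _ => h.contDiffOn⟩

variable [NeZero n]

theorem christoffel_minkowskiMetric (x : Fin n → ℝ) (l μ ν : Fin n) :
    christoffel (minkowskiMetric n) x l μ ν = 0 := by
  simp [christoffel, minkowskiMetric]

theorem isCausalCovector_minkowskiMetric_iff {x p : Fin n → ℝ} :
    IsCausalCovector (minkowskiMetric n) x p ↔
      p ≠ 0 ∧ ∑ μ ∈ Finset.univ.erase 0, p μ ^ 2 ≤ p 0 ^ 2 := by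
  have hinv : (minkowskiMetric n x)⁻¹ = minkowskiMetric n x := by
    refine Matrix.inv_eq_right_inv ?_
    rw [minkowskiMetric, Matrix.diagonal_mul_diagonal, ← Matrix.diagonal_one]
    congr 1
    ext μ
    split_ifs <;> norm_num
  rw [IsCausalCovector, hinv, sum_minkowskiMetric_mul_mul, sub_nonneg]

theorem isCovariantlyConstant_segment (a b p : Fin n → ℝ) :
    IsCovariantlyConstant (minkowskiMetric n) (fun t : ℝ => a + t • (b - a)) fun _ => p := by
  refine ⟨continuousOn_const, ∅, fun t _ _ => ⟨?_, fun ν => ?_⟩⟩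
  · fun_prop
  · simpa [christoffel_minkowskiMetric] using hasDerivAt_const t (p ν)

/-- The graph on `m` vertices with a pair of opposite edges between `j` and `σ j` for every `j`. -/
def mapGraph (σ : Fin m → Fin m) : EdgeGraph m where
  numEdges := Fintype.card (Fin m × Bool)
  src e := let d := (Fintype.equivFin (Fin m × Bool)).symm e; if d.2 then σ d.1 else d.1
  tgt e := let d := (Fintype.equivFin (Fin m × Bool)).symm e; if d.2 then d.1 else σ d.1
  inv e := let d := (Fintype.equivFin (Fin m × Bool)).symm e
    Fintype.equivFin (Fin m × Bool) (d.1, !d.2)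
  inv_inv e := by simp
  inv_ne e := by
    intro h
    have h1 := congrArg (fun e => ((Fintype.equivFin (Fin m × Bool)).symm e).2) h
    simp at h1
  src_inv e := by
    simp only [Equiv.symm_apply_apply]
    cases ((Fintype.equivFin (Fin m × Bool)).symm e).2 <;> simp
  tgt_inv e := by
    simp only [Equiv.symm_apply_apply]
    cases ((Fintype.equivFin (Fin m × Bool)).symm e).2 <;> simp

/-- The immersion of `mapGraph σ` by straight segments, with constant covectors `q j` from `j` to
`σ j`. -/
def mapGraphImmersion (σ : Fin m → Fin m) (x q : Fin m → Fin n → ℝ) (hσ : ∀ j, j ≤ σ j)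
    (hq : ∀ j, q j ≠ 0 ∧ ∑ μ ∈ Finset.univ.erase 0, q j μ ^ 2 ≤ q j 0 ^ 2)
    (hq0 : ∀ j, 0 < q j 0) : GraphImmersion n (mapGraph σ) where
  pt := x
  curve e t := x ((mapGraph σ).src e) + t • (x ((mapGraph σ).tgt e) - x ((mapGraph σ).src e))
  covec e _ := let d := (Fintype.equivFin (Fin m × Bool)).symm e; if d.2 then -q d.1 else q d.1
  piecewiseSmooth e := isPiecewiseSmooth_segment _ _
  curve_zero e := by simp
  curve_one e := by simp
  covariantlyConstant e := isCovariantlyConstant_segment _ _ _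
  causal e t _ := by
    rw [isCausalCovector_minkowskiMetric_iff]
    dsimp only
    obtain ⟨j, b⟩ := (Fintype.equivFin (Fin m × Bool)).symm e
    cases b
    · exact hq j
    · exact ⟨neg_ne_zero.2 (hq j).1, by simpa using (hq j).2⟩
  curve_inv e t _ := by
    rw [(mapGraph σ).src_inv, (mapGraph σ).tgt_inv, sub_smul, one_smul, ← neg_sub (x _) (x _),
      smul_neg]
    abel
  future e h t _ := by
    simp only [mapGraph] at h ⊢
    generalize (Fintype.equivFin (Fin m × Bool)).symm e = d at h ⊢
    obtain ⟨j, b⟩ := d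
    cases b
    · exact hq0 j
    · exact absurd (hσ j) (not_le.2 h)
  covec_inv e t _ := by
    simp only [mapGraph, Equiv.symm_apply_apply]
    cases ((Fintype.equivFin (Fin m × Bool)).symm e).2 <;> simp

theorem sum_covec_mapGraphImmersion (σ : Fin m → Fin m) (x q : Fin m → Fin n → ℝ) (hσ hq hq0)
    (i : Fin m) (μ : Fin n) :
    ∑ e with (mapGraph σ).src e = i, (mapGraphImmersion σ x q hσ hq hq0).covec e 0 μ =
      q i μ - ∑ j, if σ j = i then q j μ else 0 := by
  rw [Finset.sum_filter]
  refine ((Fintype.equivFin (Fin m × Bool)).sum_comp _).symm.trans ?_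
  rw [Fintype.sum_prod_type]
  simp only [mapGraph, mapGraphImmersion, Equiv.symm_apply_apply, Fintype.sum_bool, if_true,
    Bool.false_eq_true, if_false, Pi.neg_apply, Finset.sum_add_distrib, Finset.sum_ite_eq',
    Finset.mem_univ]
  rw [add_comm, sub_eq_add_neg, ← Finset.sum_neg_distrib]
  congr 1
  exact Finset.sum_congr rfl fun j _ => by split_ifs <;> simp

/-- Momentum conservation at each vertex of the chain is `tailMomentum_telescope`: `P_i` leaves
vertex `i` and `P_{i-1}` enters it. -/
theorem mem_microlocalCone_of_nonneg_tubeCone {x k : Conf n m} (hk0 : k ≠ 0)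
    (hk : ∀ y ∈ tubeCone n m, 0 ≤ inner ℝ k (WithLp.toLp 2 y : Conf n m)) :
    (x, k) ∈ microlocalCone n m := by
  classical
  -- Edge covectors must be nonzero, so a vanishing tail momentum gets no chain edge. Such a `j`,
  -- and the last vertex, receive a pair of opposite loops carrying `±∂₀`-covectors, which cancel in
  -- the sum at the vertex.
  let active : Fin m → Prop := fun j => (j : ℕ) + 1 < m ∧ tailMomentum k j ≠ 0
  let σ : Fin m → Fin m := fun j => if h : active j then ⟨j + 1, h.1⟩ else j
  let q : Fin m → Fin n → ℝ := fun j => if active j then tailMomentum k j else Pi.single 0 1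
  have hσ : ∀ j, j ≤ σ j := fun j => by
    by_cases h : active j
    · simp only [σ, dif_pos h]; exact Fin.le_def.2 (Nat.le_succ _)
    · simp only [σ, dif_neg h]; exact le_rfl
  have hcone : ∀ j, 0 ≤ tailMomentum k j 0 ∧
      ∑ μ ∈ Finset.univ.erase 0, tailMomentum k j μ ^ 2 ≤ tailMomentum k j 0 ^ 2 := fun j =>
    sum_sq_le_of_nonneg_forwardCone (tailMomentum_nonneg hk j)
  have hq0 : ∀ j, 0 < q j 0 := fun j => by
    by_cases h : active j
    · simp only [q, if_pos h]
      -- A causal covector with zero time component vanishes altogether.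
      refine (hcone j).1.lt_of_ne fun h0 => h.2 ?_
      have h1 := (hcone j).2
      rw [← h0, zero_pow two_ne_zero] at h1
      have h2 := (Finset.sum_eq_zero_iff_of_nonneg fun μ _ => sq_nonneg (tailMomentum k j μ)).1
        (le_antisymm h1 (Finset.sum_nonneg fun μ _ => sq_nonneg _))
      ext μ
      by_cases hμ : μ = 0
      · rw [hμ, ← h0]; rfl
      · exact pow_eq_zero_iff two_ne_zero |>.1 (h2 μ (by simp [hμ]))
    · simp [q, if_neg h]
  have hq : ∀ j, q j ≠ 0 ∧ ∑ μ ∈ Finset.univ.erase 0, q j μ ^ 2 ≤ q j 0 ^ 2 := fun j => by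
    refine ⟨fun h => (hq0 j).ne' (by rw [h]; rfl), ?_⟩
    by_cases h : active j
    · simp only [q, if_pos h]; exact (hcone j).2
    · simp only [q, if_neg h]
      rw [Finset.sum_eq_zero fun μ hμ => by simp [Finset.ne_of_mem_erase hμ]]
      positivity
  refine ⟨hk0, mapGraph σ, mapGraphImmersion σ (fun i μ => x (i, μ)) q hσ hq hq0, fun i μ => rfl,
    fun i μ => ?_⟩
  change k (i, μ) = _
  rw [sum_covec_mapGraphImmersion, tailMomentum_telescope (sum_eq_zero_of_nonneg_tubeCone hk) i μ]
  have hi : ∀ c : Fin m → ℝ, c i = ∑ j, if j = i then c j else 0 := fun c => by simp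
  rw [neg_sub, hi fun j => tailMomentum k j μ, hi fun j => q j μ, ← Finset.sum_sub_distrib,
    ← Finset.sum_sub_distrib]
  refine Finset.sum_congr rfl fun j _ => ?_
  by_cases h : active j
  · have h1 : σ j = i ↔ (j : ℕ) + 1 = i := by simp only [σ, dif_pos h, Fin.ext_iff]
    simp only [h1, q, if_pos h]
  · have h1 : σ j = j := dif_neg h
    have h2 : (if (j : ℕ) + 1 = i then tailMomentum k j μ else 0) = 0 ∧
        tailMomentum k j μ = 0 := by
      by_cases hj : (j : ℕ) + 1 < m
      · have h3 : tailMomentum k j = 0 := by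
          by_contra h4
          exact h ⟨hj, h4⟩
        simp [h3]
      · have h3 : tailMomentum k j μ = 0 :=
          Finset.sum_eq_zero fun l _ => if_neg (by rw [Fin.lt_def]; omega)
        simp [h3]
    rw [h1, h2.1, h2.2]
    simp

end Graph

end

/-! ### The wavefront set bound -/

theorem mainTheorem7 (n : ℕ) [NeZero n] (hn : 2 ≤ n) (w : BorchersUhlmann.State n)
    (hw : ∀ m, 1 ≤ m → IsTubeBoundaryValue n m (w.pointFunction m)) :
    w.IsAnalyticMicrolocalSpectrum := by
  rintro m hm ⟨x, k⟩ ⟨hk0, hreg⟩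
  refine mem_microlocalCone_of_nonneg_tubeCone hk0 fun y hy => ?_
  by_contra! h
  exact hreg (isAnalyticRegular_of_isTubeBoundaryValue (hw m hm) hy h)
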